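/- Let $\zeta$ be the Riemann zeta function, $\Upsilon(s)=\zeta(s)\,\Gamma(s/2)\,\pi^{-s/2}$, $\Upsilon_R=\operatorname{Re}\Upsilon$, $\Upsilon_I=\operatorname{Im}\Upsilon$, and write $G=\Gamma(3/4)$. The following seven sums converge and have the stated values: $$\sum_{n=1}^{\infty}-n^{2}e^{-\pi n^2}=-\frac{1}{8\pi^{3/4}G},$$ $$\sum_{n=1}^{\infty}n^{4}e^{-\pi n^2}=\frac{3+\frac{\pi^4}{2G^8}}{32\,\pi^{7/4}G},$$ $$\sum_{n=1}^{\infty}-n^{6}e^{-\pi n^2}=-\frac{15}{128\,\pi^{11/4}G}-\frac{15\,\pi^{5/4}}{256\,G^{9}},$$ $$\sum_{n=1}^{\infty}n^{8}e^{-\pi n^2}=\frac{105}{512\,\pi^{15/4}G}+\frac{105\,\pi^{1/4}}{512\,G^{9}}-\frac{\pi^{17/4}}{2048\,G^{17}},$$ $$\sum_{n=1}^{\infty}-n^{10}e^{-\pi n^2}=-\frac{945}{2048\,\pi^{19/4}G}-\frac{1575}{2048\,\pi^{3/4}G^{9}}+\frac{45\,\pi^{13/4}}{8192\,G^{17}},$$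 $$\sum_{n=1}^{\infty}n^{12}e^{-\pi n^2}=\frac{10395}{8192\,\pi^{23/4}G}+\frac{51975}{16384\,\pi^{7/4}G^{9}}-\frac{1485\,\pi^{9/4}}{32768\,G^{17}}+\frac{51\,\pi^{25/4}}{65536\,G^{25}},$$ $$\sum_{n=1}^{\infty}-n^{14}e^{-\pi n^2}=-\frac{135135}{32768\,\pi^{27/4}G}-\frac{945945}{65536\,\pi^{11/4}G^{9}}+\frac{45045\,\pi^{5/4}}{131072\,G^{17}}-\frac{4641\,\pi^{21/4}}{262144\,G^{25}}.$$ Moreover the following seven integrals converge absolutely and have the stated values: $$\int_0^\infty v\,\Upsilon_I(2iv)\,dv=-\frac{\pi}{4}\left(\frac{\pi^{1/4}}{2G}-1\right),$$ $$\int_0^\infty v^2\,\Upsilon_R(2iv)\,dv=\frac{\pi}{8}+\frac{\pi^{5/4}}{32\,G}-\frac{\pi^{21/4}}{64\,G^{9}},$$ $$\int_0^\infty v^3\,\Upsilon_I(2iv)\,dv=\frac{3\pi^{21/4}-10\pi^{5/4}G^{8}-16\pi G^{9}}{256\,G^{9}},$$ $$\int_0^\infty v^4\,\Upsilon_R(2iv)\,dv=\frac{-\pi^{37/4}-76\pi^{21/4}G^{8}+68\pi^{5/4}G^{16}-64\pi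 G^{17}}{2048\,G^{17}},$$ $$\int_0^\infty v^5\,\Upsilon_I(2iv)\,dv=\frac{5\pi^{37/4}+420\pi^{21/4}G^{8}-484\pi^{5/4}G^{16}+128\pi G^{17}}{8192\,G^{17}},$$ $$\int_0^\infty v^6\,\Upsilon_R(2iv)\,dv=\frac{-51\pi^{53/4}-350\pi^{37/4}G^{8}-11644\pi^{21/4}G^{16}+5768\pi^{5/4}G^{24}+512\pi G^{25}}{65536\,G^{25}},$$ $$\int_0^\infty v^7\,\Upsilon_I(2iv)\,dv=\frac{357\pi^{53/4}+2590\pi^{37/4}G^{8}+93492\pi^{21/4}G^{16}-54760\pi^{5/4}G^{24}-1024\pi G^{25}}{262144\,G^{25}}.$$ -/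

import Mathlib

open Real MeasureTheory Set

/-- The completed zeta function `Υ(s) = ζ(s) Γ(s/2) π^(-s/2)`. -/
noncomputable def Upsilon (s : ℂ) : ℂ :=
  riemannZeta s * Complex.Gamma (s / 2) * (π : ℂ) ^ (-s / 2)

/-- The real part of `Υ`. -/
noncomputable def UpsilonR (s : ℂ) : ℝ := (Upsilon s).re

/-- The imaginary part of `Υ`. -/
noncomputable def UpsilonI (s : ℂ) : ℝ := (Upsilon s).im

/-- The integral of `f` over `(0, ∞)` converges absolutely and has the value `a`. -/
def HasHalfLineIntegral (f : ℝ → ℝ) (a : ℝ) : Prop :=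
  IntegrableOn f (Ioi 0) ∧ ∫ v in Ioi (0 : ℝ), f v = a

/-! Write θ₃(t) = ∑ exp(-πn²t) and θ₄(t) = ∑ (-1)ⁿ exp(-πn²t) over the integers, and put p =
π^(1/4), G = Γ(3/4). Both halves of the theorem reduce to the derivatives of θ₃ at t = 1, up to
order seven.

These derivatives come from a closed differential system. With L = 2θ₃'/θ₃, E = π(θ₃⁴ - 2θ₄⁴) and N
= π²θ₄⁴(θ₃⁴ - θ₄⁴), one has L' = L² + N/4, E' = 2EL - 2N and N' = 4NL + NE, so each derivative of θ₃
is θ₃ times a polynomial in L, E, N. The system is obtained without modular forms. The doubling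
formulas `thetaThree_sq_add_thetaFour_sq` and `thetaThree_mul_thetaFour` show that a suitable
expression is unchanged under t ↦ 2t, hence equal to its limit along 2ⁿt. This argument gives the
Wronskian (`theta_wronskian`) and the Riccati equation (`thetaLogDeriv_eq`).

The initial values at 1 come from the inversion θ₃(1/t) = √t θ₃(t), which gives L = -1/2 and E = 0,
and from Gauss's AGM integral. Doubling is an AGM step for (θ₃², θ₄²), so the integral of that pair
is π/2; at t = 1 it is also a Beta integral, and θ₃(1) = p/G follows (`thetaThree_one`).

For the integrals, let M(y) = (θ₃(e^y) - 1 - e^(-y/2))/2. Its derivative is smooth, with all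
derivatives integrable, and its Fourier transform is, up to scaling, v Υ(2iv)
(`integral_cexp_mul_mellinJet`). Fourier inversion at 0, applied to the derivatives of M', turns the
moments of Υ on the imaginary axis into derivatives of M at 0, that is, into values of the theta
series at t = 1. -/

open Filter Topology
open scoped FourierTransform

/-! ### Theta series with bounded coefficients: termwise derivatives and decay. -/

/-- The theta series `∑ c(n) n^(2k) exp (-π n² t)` over the integers. -/
noncomputable def thetaSeries (c : ℤ → ℝ) (k : ℕ) (t : ℝ) : ℝ :=
  ∑' n : ℤ, c n * (n : ℝ) ^ (2 * k) * exp (-π * (n : ℝ) ^ 2 * t)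

lemma summable_pow_mul_exp_neg_sq (k : ℕ) {t : ℝ} (ht : 0 < t) :
    Summable fun n : ℤ => (n : ℝ) ^ (2 * k) * exp (-π * (n : ℝ) ^ 2 * t) := by
  refine (summable_pow_mul_jacobiTheta₂_term_bound 0 ht (2 * k)).congr fun n => ?_
  rw [Int.cast_abs, pow_mul, pow_mul, sq_abs]
  congr 2
  ring

lemma abs_thetaSeries_term_le {c : ℤ → ℝ} (hc : ∀ n, |c n| ≤ 1) (k : ℕ) (t : ℝ) (n : ℤ) :
    |c n * (n : ℝ) ^ (2 * k) * exp (-π * (n : ℝ) ^ 2 * t)| ≤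
      (n : ℝ) ^ (2 * k) * exp (-π * (n : ℝ) ^ 2 * t) := by
  have h : 0 ≤ (n : ℝ) ^ (2 * k) := by rw [pow_mul]; positivity
  rw [mul_assoc, abs_mul, abs_of_nonneg (mul_nonneg h (exp_pos _).le)]
  exact mul_le_of_le_one_left (mul_nonneg h (exp_pos _).le) (hc n)

lemma summable_thetaSeries {c : ℤ → ℝ} (hc : ∀ n, |c n| ≤ 1) (k : ℕ) {t : ℝ} (ht : 0 < t) :
    Summable fun n : ℤ => c n * (n : ℝ) ^ (2 * k) * exp (-π * (n : ℝ) ^ 2 * t) :=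
  .of_norm_bounded (summable_pow_mul_exp_neg_sq k ht) (abs_thetaSeries_term_le hc k t)

lemma hasDerivAt_thetaSeries {c : ℤ → ℝ} (hc : ∀ n, |c n| ≤ 1) (k : ℕ) {t : ℝ} (ht : 0 < t) :
    HasDerivAt (thetaSeries c k) (-π * thetaSeries c (k + 1) t) t := by
  have key := hasDerivAt_tsum_of_isPreconnected
    (u := fun n : ℤ => π * ((n : ℝ) ^ (2 * (k + 1)) * exp (-π * (n : ℝ) ^ 2 * (t / 2))))
    (g := fun (n : ℤ) t => c n * (n : ℝ) ^ (2 * k) * exp (-π * (n : ℝ) ^ 2 * t))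
    (g' := fun (n : ℤ) t =>
      -π * (c n * (n : ℝ) ^ (2 * (k + 1)) * exp (-π * (n : ℝ) ^ 2 * t)))
    -- On (t/2, ∞) every differentiated term is dominated by its size at t/2.
    (t := Ioi (t / 2)) (y₀ := t) (y := t)
    ((summable_pow_mul_exp_neg_sq (k + 1) (half_pos ht)).mul_left π) isOpen_Ioi
    isPreconnected_Ioi ?_ ?_ (by simpa using ht) (summable_thetaSeries hc k ht) (by simpa using ht)
  · rw [tsum_mul_left] at key
    exact key
  · intro n y _
    refine ((((hasDerivAt_id y).const_mul (-π * (n : ℝ) ^ 2)).exp).const_mul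
      (c n * (n : ℝ) ^ (2 * k))).congr_deriv ?_
    simp only [id]
    ring
  · intro n y hy
    have h : 0 ≤ (n : ℝ) ^ (2 * (k + 1)) := by rw [pow_mul]; positivity
    rw [norm_mul, norm_neg, Real.norm_of_nonneg pi_pos.le]
    refine mul_le_mul_of_nonneg_left ((abs_thetaSeries_term_le hc (k + 1) y n).trans ?_) pi_pos.le
    refine mul_le_mul_of_nonneg_left (exp_le_exp.2 ?_) h
    have : 0 ≤ π * (n : ℝ) ^ 2 := by positivity
    nlinarith [mem_Ioi.1 hy]

/-- Once the term n = 0 is absent, n = ±1 dominate. These first-order asymptotics fix the constants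
in the doubling arguments below. -/
lemma tendsto_exp_mul_thetaSeries {c : ℤ → ℝ} (hc : ∀ n, |c n| ≤ 1) (k : ℕ)
    (h0 : c 0 = 0 ∨ k ≠ 0) :
    Tendsto (fun t => exp (π * t) * thetaSeries c k t) atTop (𝓝 (c 1 + c (-1))) := by
  have hz : c 0 * ((0 : ℤ) : ℝ) ^ (2 * k) = 0 := by
    rcases h0 with h | h
    · simp [h]
    · simp [h]
  have hsum : ∑' n : ℤ, (if n = 1 ∨ n = -1 then c n else 0) = c 1 + c (-1) := by
    rw [tsum_eq_sum (s := {1, -1})]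
    · rw [Finset.sum_pair (by norm_num)]; simp
    · intro n hn
      simp only [Finset.mem_insert, Finset.mem_singleton] at hn
      simp [hn]
  rw [← hsum]
  simp_rw [thetaSeries, ← tsum_mul_left]
  refine tendsto_tsum_of_dominated_convergence
    (bound := fun n : ℤ => exp π * ((n : ℝ) ^ (2 * k) * exp (-π * (n : ℝ) ^ 2 * 1)))
    ((summable_pow_mul_exp_neg_sq k one_pos).mul_left _) ?_ ?_
  · intro n
    by_cases hn0 : n = 0
    · subst hn0
      rw [hz]; simp
    by_cases hn : n = 1 ∨ n = -1
    · simp only [hn, if_true]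
      refine tendsto_const_nhds.congr fun t => ?_
      have h1 : (n : ℝ) ^ 2 = 1 := by rcases hn with rfl | rfl <;> norm_num
      rw [pow_mul, h1, one_pow]
      have : exp (π * t) * exp (-π * 1 * t) = 1 := by rw [← exp_add]; simp
      linear_combination (-c n) * this
    · simp only [hn, if_false]
      have h4 : (4 : ℝ) ≤ (n : ℝ) ^ 2 := by
        have : 2 ≤ |n| := by
          by_contra h
          have := abs_lt.1 (not_le.1 h)
          omega
        have h2 : (2 : ℝ) ≤ |(n : ℝ)| := by exact_mod_cast this
        nlinarith [sq_abs (n : ℝ)]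
      have hlim : Tendsto (fun t : ℝ => c n * (n : ℝ) ^ (2 * k) * exp ((π - π * (n : ℝ) ^ 2) * t))
          atTop (𝓝 (c n * (n : ℝ) ^ (2 * k) * 0)) := by
        refine (tendsto_exp_atBot.comp ?_).const_mul _
        exact tendsto_id.const_mul_atTop_of_neg (by nlinarith [pi_pos])
      rw [mul_zero] at hlim
      refine hlim.congr fun t => ?_
      rw [mul_left_comm, ← exp_add]
      ring_nf
  · filter_upwards [eventually_ge_atTop 1] with t ht n
    rw [norm_mul, Real.norm_of_nonneg (exp_pos _).le]
    by_cases hn0 : n = 0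
    · subst hn0
      rw [hz]; simp only [zero_mul, norm_zero, mul_zero]
      have : 0 ≤ ((0 : ℤ) : ℝ) ^ (2 * k) := by rw [pow_mul]; positivity
      positivity
    have h : 0 ≤ (n : ℝ) ^ (2 * k) := by rw [pow_mul]; positivity
    refine (mul_le_mul_of_nonneg_left (abs_thetaSeries_term_le hc k t n) (exp_pos _).le).trans ?_
    rw [mul_left_comm, mul_left_comm (exp π), ← exp_add, ← exp_add]
    refine mul_le_mul_of_nonneg_left (exp_le_exp.2 ?_) h
    have h1 : (1 : ℝ) ≤ (n : ℝ) ^ 2 := by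
      have : (1 : ℝ) ≤ |(n : ℝ)| := by exact_mod_cast Int.one_le_abs hn0
      nlinarith [sq_abs (n : ℝ)]
    -- The comparison with t = 1 is the inequality (t - 1)(n² - 1) ≥ 0.
    nlinarith [mul_nonneg pi_pos.le (mul_nonneg (sub_nonneg.2 ht) (sub_nonneg.2 h1))]

/-! ### The theta constants: doubling, inversion, positivity. -/

/-- The theta constant `∑ exp (-π n² t)`. -/
noncomputable def thetaThree : ℝ → ℝ := thetaSeries (fun _ => 1) 0

/-- The theta constant `∑ (-1)ⁿ exp (-π n² t)`. -/
noncomputable def thetaFour : ℝ → ℝ := thetaSeries (fun n => (-1) ^ n) 0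

lemma abs_one_le (_ : ℤ) : |(1 : ℝ)| ≤ 1 := by simp

lemma abs_neg_one_zpow_le (n : ℤ) : |(-1 : ℝ) ^ n| ≤ 1 := by simp

lemma abs_ite_ne_zero_le {c : ℤ → ℝ} (hc : ∀ n, |c n| ≤ 1) (n : ℤ) :
    |if n = 0 then 0 else c n| ≤ 1 := by
  split_ifs
  · simp
  · exact hc n

lemma thetaSeries_zero_eq_add {c : ℤ → ℝ} (hc : ∀ n, |c n| ≤ 1) {t : ℝ} (ht : 0 < t) :
    thetaSeries c 0 t = c 0 + thetaSeries (fun n => if n = 0 then 0 else c n) 0 t := by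
  rw [thetaSeries, (summable_thetaSeries hc 0 ht).tsum_eq_add_tsum_ite 0, thetaSeries]
  congr 1
  · simp
  · refine tsum_congr fun n => ?_
    split_ifs <;> simp

lemma thetaSeries_succ_eq (c : ℤ → ℝ) (k : ℕ) (t : ℝ) :
    thetaSeries c (k + 1) t = thetaSeries (fun n => if n = 0 then 0 else c n) (k + 1) t := by
  refine tsum_congr fun n => ?_
  by_cases h : n = 0 <;> simp [h]

lemma tendsto_exp_mul_thetaSeries_sub {c : ℤ → ℝ} (hc : ∀ n, |c n| ≤ 1) :
    Tendsto (fun t => exp (π * t) * (thetaSeries c 0 t - c 0)) atTop (𝓝 (c 1 + c (-1))) := by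
  have h := tendsto_exp_mul_thetaSeries (abs_ite_ne_zero_le hc) 0 (Or.inl (by simp))
  simp only [one_ne_zero, if_false, neg_eq_zero] at h
  refine h.congr' ?_
  filter_upwards [eventually_gt_atTop 0] with t ht
  rw [thetaSeries_zero_eq_add hc ht]
  ring

lemma summable_thetaSeries_prod {c d : ℤ → ℝ} (hc : ∀ n, |c n| ≤ 1) (hd : ∀ n, |d n| ≤ 1) {t : ℝ}
    (ht : 0 < t) : Summable fun p : ℤ × ℤ =>
      c p.1 * d p.2 * exp (-π * ((p.1 : ℝ) ^ 2 + (p.2 : ℝ) ^ 2) * t) := by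
  refine (summable_mul_of_summable_norm (summable_thetaSeries hc 0 ht).norm
    (summable_thetaSeries hd 0 ht).norm).congr fun p => ?_
  rw [show -π * ((p.1 : ℝ) ^ 2 + (p.2 : ℝ) ^ 2) * t =
    -π * (p.1 : ℝ) ^ 2 * t + -π * (p.2 : ℝ) ^ 2 * t by ring, exp_add]
  ring

lemma thetaSeries_mul_thetaSeries {c d : ℤ → ℝ} (hc : ∀ n, |c n| ≤ 1) (hd : ∀ n, |d n| ≤ 1)
    {t : ℝ} (ht : 0 < t) : thetaSeries c 0 t * thetaSeries d 0 t = ∑' p : ℤ × ℤ,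
      c p.1 * d p.2 * exp (-π * ((p.1 : ℝ) ^ 2 + (p.2 : ℝ) ^ 2) * t) := by
  rw [thetaSeries, thetaSeries, tsum_mul_tsum_of_summable_norm (summable_thetaSeries hc 0 ht).norm
    (summable_thetaSeries hd 0 ht).norm]
  refine tsum_congr fun p => ?_
  rw [show -π * ((p.1 : ℝ) ^ 2 + (p.2 : ℝ) ^ 2) * t =
    -π * (p.1 : ℝ) ^ 2 * t + -π * (p.2 : ℝ) ^ 2 * t by ring, exp_add]
  ring

/-- The map (m, n) ↦ (m + n, m - n) is a bijection from ℤ² onto the pairs of equal parity. Since it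
doubles m² + n², it is the source of both doubling formulas. -/
lemma tsum_add_sub_eq_tsum_even (f : ℤ × ℤ → ℝ) :
    ∑' p : ℤ × ℤ, f (p.1 + p.2, p.1 - p.2) =
      ∑' p : ℤ × ℤ, if Even (p.1 + p.2) then f p else 0 := by
  have hinj : Function.Injective fun p : ℤ × ℤ => (p.1 + p.2, p.1 - p.2) := by
    rintro ⟨a, b⟩ ⟨c, d⟩ h
    simp only [Prod.mk.injEq] at h ⊢
    omega
  rw [← hinj.tsum_eq (f := fun p : ℤ × ℤ => if Even (p.1 + p.2) then f p else 0)]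
  · refine tsum_congr fun p => ?_
    rw [if_pos]
    exact ⟨p.1, by ring⟩
  · rintro ⟨m, n⟩ h
    have : Even (m + n) := by
      by_contra h'
      exact h (if_neg h')
    obtain ⟨r, hr⟩ := this
    refine ⟨(r, m - r), ?_⟩
    simp only [Prod.mk.injEq]
    omega

lemma neg_one_zpow_of_not_even_add {m n : ℤ} (h : ¬Even (m + n)) :
    (-1 : ℝ) ^ m = -(-1) ^ n := by
  rcases Int.even_or_odd m with hm | hm <;> rcases Int.even_or_odd n with hn | hn
  · exact absurd (hm.add hn) h
  · rw [hm.neg_one_zpow, hn.neg_one_zpow]; norm_num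
  · rw [hm.neg_one_zpow, hn.neg_one_zpow]
  · exact absurd (hm.add_odd hn) h

lemma neg_one_zpow_of_even_add {m n : ℤ} (h : Even (m + n)) : (-1 : ℝ) ^ m = (-1) ^ n := by
  rcases Int.even_or_odd m with hm | hm <;> rcases Int.even_or_odd n with hn | hn
  · rw [hm.neg_one_zpow, hn.neg_one_zpow]
  · exact absurd h (Int.not_even_iff_odd.2 (hm.add_odd hn))
  · exact absurd h (Int.not_even_iff_odd.2 (hm.add_even hn))
  · rw [hm.neg_one_zpow, hn.neg_one_zpow]

lemma thetaThree_sq_add_thetaFour_sq {t : ℝ} (ht : 0 < t) :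
    thetaThree t ^ 2 + thetaFour t ^ 2 = 2 * thetaThree (2 * t) ^ 2 := by
  simp only [sq, thetaThree, thetaFour]
  rw [thetaSeries_mul_thetaSeries abs_one_le abs_one_le ht,
    thetaSeries_mul_thetaSeries abs_neg_one_zpow_le abs_neg_one_zpow_le ht,
    thetaSeries_mul_thetaSeries abs_one_le abs_one_le (mul_pos two_pos ht),
    ← (summable_thetaSeries_prod abs_one_le abs_one_le ht).tsum_add
      (summable_thetaSeries_prod abs_neg_one_zpow_le abs_neg_one_zpow_le ht)]
  have := tsum_add_sub_eq_tsum_even fun p =>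
    1 * 1 * exp (-π * ((p.1 : ℝ) ^ 2 + (p.2 : ℝ) ^ 2) * t)
  have h2 : ∀ p : ℤ × ℤ, -π * ((p.1 : ℝ) ^ 2 + (p.2 : ℝ) ^ 2) * (2 * t) =
      -π * (((p.1 + p.2 : ℤ) : ℝ) ^ 2 + ((p.1 - p.2 : ℤ) : ℝ) ^ 2) * t := fun p => by
    push_cast; ring
  simp_rw [h2]
  rw [this, ← tsum_mul_left]
  refine tsum_congr fun p => ?_
  have hs : ((-1 : ℝ) ^ p.2) * (-1) ^ p.2 = 1 := by rw [← mul_zpow]; simp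
  split_ifs with h
  · rw [neg_one_zpow_of_even_add h, hs]
    ring
  · rw [neg_one_zpow_of_not_even_add h]
    linear_combination (-exp (-π * ((p.1 : ℝ) ^ 2 + (p.2 : ℝ) ^ 2) * t)) * hs

lemma thetaThree_mul_thetaFour {t : ℝ} (ht : 0 < t) :
    thetaThree t * thetaFour t = thetaFour (2 * t) ^ 2 := by
  -- Symmetrizing gives the weight (-1)^m + (-1)^n, which vanishes exactly on pairs of opposite
  -- parity.
  suffices thetaFour t * thetaThree t + thetaThree t * thetaFour t =
      2 * (thetaFour (2 * t) * thetaFour (2 * t)) by linarith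
  simp only [thetaThree, thetaFour]
  rw [thetaSeries_mul_thetaSeries abs_neg_one_zpow_le abs_one_le ht,
    thetaSeries_mul_thetaSeries abs_one_le abs_neg_one_zpow_le ht,
    thetaSeries_mul_thetaSeries abs_neg_one_zpow_le abs_neg_one_zpow_le (mul_pos two_pos ht),
    ← (summable_thetaSeries_prod abs_neg_one_zpow_le abs_one_le ht).tsum_add
      (summable_thetaSeries_prod abs_one_le abs_neg_one_zpow_le ht)]
  have := tsum_add_sub_eq_tsum_even fun p =>
    (-1) ^ p.1 * exp (-π * ((p.1 : ℝ) ^ 2 + (p.2 : ℝ) ^ 2) * t)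
  have h2 : ∀ p : ℤ × ℤ, -π * ((p.1 : ℝ) ^ 2 + (p.2 : ℝ) ^ 2) * (2 * t) =
      -π * (((p.1 + p.2 : ℤ) : ℝ) ^ 2 + ((p.1 - p.2 : ℤ) : ℝ) ^ 2) * t := fun p => by
    push_cast; ring
  simp_rw [h2, ← zpow_add₀ (neg_ne_zero.2 (one_ne_zero (α := ℝ)))]
  rw [this, ← tsum_mul_left]
  refine tsum_congr fun p => ?_
  split_ifs with h
  · rw [neg_one_zpow_of_even_add h]
    ring
  · rw [neg_one_zpow_of_not_even_add h]
    ring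

lemma thetaThree_inv {t : ℝ} (ht : 0 < t) : thetaThree t⁻¹ = √t * thetaThree t := by
  have h := Real.tsum_exp_neg_mul_int_sq ht
  have h1 : thetaThree t = ∑' n : ℤ, exp (-π * t * (n : ℝ) ^ 2) :=
    tsum_congr fun n => by rw [mul_zero, pow_zero, one_mul, one_mul]; ring_nf
  have h2 : thetaThree t⁻¹ = ∑' n : ℤ, exp (-π / t * (n : ℝ) ^ 2) :=
    tsum_congr fun n => by rw [mul_zero, pow_zero, one_mul, one_mul]; ring_nf
  rw [← h1, ← h2, ← sqrt_eq_rpow] at h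
  rw [h]
  field_simp [(sqrt_pos.2 ht).ne']

lemma one_lt_thetaThree {t : ℝ} (ht : 0 < t) : 1 < thetaThree t := by
  rw [thetaThree, thetaSeries_zero_eq_add abs_one_le ht, lt_add_iff_pos_right]
  refine (summable_thetaSeries (abs_ite_ne_zero_le abs_one_le) 0 ht).tsum_pos (fun n => ?_) 1 ?_
  · split_ifs <;> simp [exp_nonneg]
  · simp [exp_pos]

lemma thetaThree_pos {t : ℝ} (ht : 0 < t) : 0 < thetaThree t := one_pos.trans (one_lt_thetaThree ht)

lemma thetaFour_lt_thetaThree {t : ℝ} (ht : 0 < t) : thetaFour t < thetaThree t := by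
  refine (summable_thetaSeries abs_neg_one_zpow_le 0 ht).tsum_lt_tsum (i := 1) (fun n => ?_) ?_
    (summable_thetaSeries abs_one_le 0 ht)
  · simp only [mul_zero, pow_zero, mul_one]
    exact mul_le_mul_of_nonneg_right ((le_abs_self _).trans (abs_neg_one_zpow_le n)) (exp_pos _).le
  · simp only [mul_zero, pow_zero, mul_one, zpow_one]
    linarith [exp_pos (-π * ((1 : ℤ) : ℝ) ^ 2 * t)]

lemma tendsto_thetaSeries_atTop {c : ℤ → ℝ} (hc : ∀ n, |c n| ≤ 1) :
    Tendsto (thetaSeries c 0) atTop (𝓝 (c 0)) := by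
  have h : Tendsto (fun t => exp (-(π * t))) atTop (𝓝 0) :=
    tendsto_exp_neg_atTop_nhds_zero.comp (tendsto_id.const_mul_atTop pi_pos)
  have := (h.mul (tendsto_exp_mul_thetaSeries_sub hc)).add_const (c 0)
  rw [zero_mul, zero_add] at this
  refine this.congr fun t => ?_
  rw [← mul_assoc, ← exp_add]
  simp

lemma tendsto_thetaThree_atTop : Tendsto thetaThree atTop (𝓝 1) :=
  tendsto_thetaSeries_atTop abs_one_le

lemma tendsto_thetaFour_atTop : Tendsto thetaFour atTop (𝓝 1) := by
  simpa using! tendsto_thetaSeries_atTop abs_neg_one_zpow_le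

lemma tendsto_two_pow_mul_atTop {t : ℝ} (ht : 0 < t) :
    Tendsto (fun n : ℕ => (2 : ℝ) ^ n * t) atTop atTop :=
  (tendsto_pow_atTop_atTop_of_one_lt one_lt_two).atTop_mul_const ht

lemma thetaFour_pos {t : ℝ} (ht : 0 < t) : 0 < thetaFour t := by
  have hnn : 0 ≤ thetaFour t := by
    have h := thetaThree_mul_thetaFour ht
    exact nonneg_of_mul_nonneg_right (h ▸ sq_nonneg (thetaFour (2 * t))) (thetaThree_pos ht)
  -- A zero would propagate to every 2ⁿt, against the limit 1 at infinity.
  refine hnn.lt_of_ne' fun h0 => ?_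
  have hz : ∀ n : ℕ, thetaFour (2 ^ n * t) = 0 := by
    intro n
    induction n with
    | zero => simpa using h0
    | succ n ih =>
      have h := thetaThree_mul_thetaFour (t := 2 ^ n * t) (by positivity)
      rw [ih, mul_zero] at h
      rw [pow_succ', mul_assoc]
      exact pow_eq_zero_iff two_ne_zero |>.1 h.symm
  have := tendsto_thetaFour_atTop.comp (tendsto_two_pow_mul_atTop ht)
  exact zero_ne_one (tendsto_nhds_unique (tendsto_const_nhds.congr fun n => (hz n).symm) this)

/-- Inversion links 1/2 and 2, and doubling links both to 1. It follows that θ₃(1/2)² = θ₃(1)² +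
θ₄(1)² and θ₄(1/2)² = θ₃(1)² - θ₄(1)², while the product of the left sides is θ₄(1)⁴. -/
lemma two_mul_thetaFour_one_pow_four : 2 * thetaFour 1 ^ 4 = thetaThree 1 ^ 4 := by
  have h1 := thetaThree_sq_add_thetaFour_sq one_pos
  have h2 := thetaThree_sq_add_thetaFour_sq (t := 2⁻¹) (by norm_num)
  have h3 := thetaThree_mul_thetaFour (t := 2⁻¹) (by norm_num)
  have h4 := thetaThree_inv two_pos
  norm_num at h1 h2 h3 h4
  have h5 : thetaThree (1 / 2) ^ 2 = 2 * thetaThree 2 ^ 2 := by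
    rw [h4, mul_pow, sq_sqrt two_pos.le]
  have h6 : (thetaThree (1 / 2) * thetaFour (1 / 2)) ^ 2 = thetaFour 1 ^ 4 := by rw [h3]; ring
  rw [mul_pow, show thetaFour (1 / 2) ^ 2 = thetaThree 1 ^ 2 - thetaFour 1 ^ 2 by linarith,
    show thetaThree (1 / 2) ^ 2 = thetaThree 1 ^ 2 + thetaFour 1 ^ 2 by linarith] at h6
  linarith

/-! ### Derivatives of the theta constants and their Wronskian. -/

/-- The derivative of `thetaThree`. -/
noncomputable def thetaThreeDeriv (t : ℝ) : ℝ := -π * thetaSeries (fun _ => 1) 1 t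

/-- The second derivative of `thetaThree`. -/
noncomputable def thetaThreeDeriv₂ (t : ℝ) : ℝ := π ^ 2 * thetaSeries (fun _ => 1) 2 t

/-- The derivative of `thetaFour`. -/
noncomputable def thetaFourDeriv (t : ℝ) : ℝ := -π * thetaSeries (fun n => (-1) ^ n) 1 t

lemma hasDerivAt_thetaThree {t : ℝ} (ht : 0 < t) : HasDerivAt thetaThree (thetaThreeDeriv t) t :=
  hasDerivAt_thetaSeries abs_one_le 0 ht

lemma hasDerivAt_thetaFour {t : ℝ} (ht : 0 < t) : HasDerivAt thetaFour (thetaFourDeriv t) t :=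
  hasDerivAt_thetaSeries abs_neg_one_zpow_le 0 ht

lemma hasDerivAt_thetaThreeDeriv {t : ℝ} (ht : 0 < t) :
    HasDerivAt thetaThreeDeriv (thetaThreeDeriv₂ t) t := by
  refine ((hasDerivAt_thetaSeries abs_one_le 1 ht).const_mul (-π)).congr_deriv ?_
  rw [thetaThreeDeriv₂]
  ring

lemma hasDerivAt_comp_two_mul {f : ℝ → ℝ} {f' t : ℝ} (h : HasDerivAt f f' (2 * t)) :
    HasDerivAt (fun s => f (2 * s)) (2 * f') t := by
  have h2 : HasDerivAt (fun s : ℝ => 2 * s) 2 t := by simpa using (hasDerivAt_id t).const_mul 2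
  exact (h.comp t h2).congr_deriv (mul_comm _ _)

lemma eq_deriv_of_eqOn_Ioi {f g : ℝ → ℝ} {f' g' t : ℝ} (ht : 0 < t) (h : EqOn f g (Ioi 0))
    (hf : HasDerivAt f f' t) (hg : HasDerivAt g g' t) : f' = g' :=
  hf.unique (hg.congr_of_eventuallyEq (h.eventuallyEq_of_mem (Ioi_mem_nhds ht)))

lemma thetaThree_deriv_doubling {t : ℝ} (ht : 0 < t) :
    thetaThree t * thetaThreeDeriv t + thetaFour t * thetaFourDeriv t =
      4 * (thetaThree (2 * t) * thetaThreeDeriv (2 * t)) := by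
  have := eq_deriv_of_eqOn_Ioi ht (fun s hs => thetaThree_sq_add_thetaFour_sq hs)
    (((hasDerivAt_thetaThree ht).pow 2).add ((hasDerivAt_thetaFour ht).pow 2))
    (((hasDerivAt_comp_two_mul (hasDerivAt_thetaThree (mul_pos two_pos ht))).pow 2).const_mul 2)
  push_cast at this
  linarith

lemma thetaFour_deriv_doubling {t : ℝ} (ht : 0 < t) :
    thetaThreeDeriv t * thetaFour t + thetaThree t * thetaFourDeriv t =
      4 * (thetaFour (2 * t) * thetaFourDeriv (2 * t)) := by
  have := eq_deriv_of_eqOn_Ioi ht (fun s hs => thetaThree_mul_thetaFour hs)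
    ((hasDerivAt_thetaThree ht).mul (hasDerivAt_thetaFour ht))
    ((hasDerivAt_comp_two_mul (hasDerivAt_thetaFour (mul_pos two_pos ht))).pow 2)
  push_cast at this
  linarith

lemma tendsto_exp_mul_thetaThreeDeriv :
    Tendsto (fun t => exp (π * t) * thetaThreeDeriv t) atTop (𝓝 (-2 * π)) := by
  have := (tendsto_exp_mul_thetaSeries abs_one_le 1 (Or.inr one_ne_zero)).const_mul (-π)
  rw [show -π * (1 + 1) = -2 * π by ring] at this
  refine this.congr fun t => ?_
  rw [thetaThreeDeriv]
  ring

lemma tendsto_exp_mul_thetaThreeDeriv₂ :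
    Tendsto (fun t => exp (π * t) * thetaThreeDeriv₂ t) atTop (𝓝 (2 * π ^ 2)) := by
  have := (tendsto_exp_mul_thetaSeries abs_one_le 2 (Or.inr two_ne_zero)).const_mul (π ^ 2)
  rw [show π ^ 2 * (1 + 1) = 2 * π ^ 2 by ring] at this
  refine this.congr fun t => ?_
  rw [thetaThreeDeriv₂]
  ring

lemma tendsto_exp_mul_thetaFourDeriv :
    Tendsto (fun t => exp (π * t) * thetaFourDeriv t) atTop (𝓝 (2 * π)) := by
  have := (tendsto_exp_mul_thetaSeries abs_neg_one_zpow_le 1 (Or.inr one_ne_zero)).const_mul (-π)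
  rw [show -π * ((-1) ^ (1 : ℤ) + (-1) ^ (-1 : ℤ)) = 2 * π by norm_num; ring] at this
  refine this.congr fun t => ?_
  rw [thetaFourDeriv]
  ring

lemma tendsto_exp_mul_thetaThree_sub_thetaFour :
    Tendsto (fun t => exp (π * t) * (thetaThree t - thetaFour t)) atTop (𝓝 4) := by
  have := (tendsto_exp_mul_thetaSeries_sub abs_one_le).sub
    (tendsto_exp_mul_thetaSeries_sub abs_neg_one_zpow_le)
  norm_num at this
  refine this.congr fun t => ?_
  rw [thetaThree, thetaFour]
  ring

lemma tendsto_exp_mul_thetaThree_pow_four_sub :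
    Tendsto (fun t => exp (π * t) * (thetaThree t ^ 4 - thetaFour t ^ 4)) atTop (𝓝 16) := by
  have := tendsto_exp_mul_thetaThree_sub_thetaFour.mul
    ((tendsto_thetaThree_atTop.add tendsto_thetaFour_atTop).mul
      ((tendsto_thetaThree_atTop.pow 2).add (tendsto_thetaFour_atTop.pow 2)))
  norm_num at this
  refine this.congr fun t => ?_
  ring

lemma thetaFour_sq_lt_thetaThree_sq {t : ℝ} (ht : 0 < t) : thetaFour t ^ 2 < thetaThree t ^ 2 :=
  pow_lt_pow_left₀ (thetaFour_lt_thetaThree ht) (thetaFour_pos ht).le two_ne_zero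

/-- The Wronskian of `thetaThree` and `thetaFour`. -/
lemma theta_wronskian {t : ℝ} (ht : 0 < t) :
    thetaThree t * thetaFourDeriv t - thetaThreeDeriv t * thetaFour t =
      π / 4 * (thetaThree t * thetaFour t * (thetaThree t ^ 4 - thetaFour t ^ 4)) := by
  set ρ : ℝ → ℝ := fun t => (thetaThree t * thetaFourDeriv t - thetaThreeDeriv t * thetaFour t) /
    (thetaThree t * thetaFour t * (thetaThree t ^ 4 - thetaFour t ^ 4)) with hρ
  have hden : ∀ {t : ℝ}, 0 < t →
      0 < thetaThree t * thetaFour t * (thetaThree t ^ 4 - thetaFour t ^ 4) := fun ht => by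
    have := pow_lt_pow_left₀ (thetaFour_lt_thetaThree ht) (thetaFour_pos ht).le four_ne_zero
    exact mul_pos (mul_pos (thetaThree_pos ht) (thetaFour_pos ht)) (sub_pos.2 this)
  have hstep : ∀ {t : ℝ}, 0 < t → ρ (2 * t) = ρ t := by
    intro t ht
    have h2 : 0 < 2 * t := mul_pos two_pos ht
    have e1 := thetaThree_sq_add_thetaFour_sq ht
    have e2 := thetaThree_mul_thetaFour ht
    have e3 := thetaThree_deriv_doubling ht
    have e4 := thetaFour_deriv_doubling ht
    have hd := hden ht
    have hd2 := hden h2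
    have hA := thetaThree_pos h2
    have hB := thetaFour_pos h2
    have ha := thetaThree_pos ht
    have hb := thetaFour_pos ht
    have hab := sub_pos.2 (thetaFour_sq_lt_thetaThree_sq ht)
    simp only [hρ]
    rw [div_eq_div_iff hd2.ne' hd.ne']
    generalize thetaThree (2 * t) = A at *
    generalize thetaFour (2 * t) = B at *
    generalize thetaThreeDeriv (2 * t) = A' at *
    generalize thetaFourDeriv (2 * t) = B' at *
    generalize thetaThree t = a at *
    generalize thetaFour t = b at *
    generalize thetaThreeDeriv t = a' at *
    generalize thetaFourDeriv t = b' at *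
    -- The next three identities express the Wronskian, the difference of fourth powers and the
    -- product at 2t by those at t. All the extra factors cancel in ρ.
    have w : 8 * (A * B) * (A * B' - A' * B) = (a ^ 2 - b ^ 2) * (a * b' - a' * b) := by
      have : 8 * (A * B) * (A * B' - A' * B) =
          (2 * A ^ 2) * (4 * (B * B')) - 2 * B ^ 2 * (4 * (A * A')) := by ring
      rw [this, ← e1, ← e2, ← e3, ← e4]
      ring
    have q : 4 * (A ^ 4 - B ^ 4) = (a ^ 2 - b ^ 2) ^ 2 := by
      have : 4 * (A ^ 4 - B ^ 4) = (2 * A ^ 2) ^ 2 - 4 * (B ^ 2) ^ 2 := by ring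
      rw [this, ← e1, ← e2]
      ring
    have p : 2 * (A * B) ^ 2 = (a ^ 2 + b ^ 2) * (a * b) := by
      rw [e1, e2]
      ring
    refine mul_left_cancel₀ (mul_pos (by norm_num : (0 : ℝ) < 8) (mul_pos hA hB)).ne' ?_
    calc 8 * (A * B) * ((A * B' - A' * B) * (a * b * (a ^ 4 - b ^ 4)))
        = (8 * (A * B) * (A * B' - A' * B)) * (a * b * (a ^ 4 - b ^ 4)) := by ring
      _ = (a * b' - a' * b) * ((a ^ 2 + b ^ 2) * (a * b)) * (a ^ 2 - b ^ 2) ^ 2 := by rw [w]; ring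
      _ = 8 * (A * B) * ((a * b' - a' * b) * (A * B * (A ^ 4 - B ^ 4))) := by
        rw [← q, ← p]; ring
  have hconst : ∀ n : ℕ, ρ (2 ^ n * t) = ρ t := by
    intro n
    induction n with
    | zero => simp
    | succ n ih => rw [pow_succ', mul_assoc, hstep (by positivity), ih]
  have hlim : Tendsto ρ atTop (𝓝 (π / 4)) := by
    have h := (((tendsto_thetaThree_atTop.mul tendsto_exp_mul_thetaFourDeriv).sub
      (tendsto_exp_mul_thetaThreeDeriv.mul tendsto_thetaFour_atTop)).div
      ((tendsto_thetaThree_atTop.mul tendsto_thetaFour_atTop).mul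
        tendsto_exp_mul_thetaThree_pow_four_sub) (by norm_num))
    -- After scaling by exp(πt), the numerator tends to 2π + 2π and the denominator to 16.
    rw [show (1 * (2 * π) - -2 * π * 1) / (1 * 1 * 16) = π / 4 by ring] at h
    refine h.congr fun t => ?_
    simp only [hρ, Pi.div_apply]
    rw [← mul_div_mul_left (thetaThree t * thetaFourDeriv t - thetaThreeDeriv t * thetaFour t) _
      (exp_pos (π * t)).ne']
    congr 1 <;> ring
  have := tendsto_nhds_unique (tendsto_const_nhds.congr fun n => (hconst n).symm)
    (hlim.comp (tendsto_two_pow_mul_atTop ht))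
  simp only [hρ] at this
  rwa [div_eq_iff (hden ht).ne'] at this

/-! ### The closed differential system and its values at 1. -/

/-- The logarithmic derivative of `thetaThree ^ 2`. -/
noncomputable def thetaLog (t : ℝ) : ℝ := 2 * thetaThreeDeriv t / thetaThree t

/-- The quasi-period `π (θ₃⁴ - 2 θ₄⁴)`. -/
noncomputable def thetaE (t : ℝ) : ℝ := π * (thetaThree t ^ 4 - 2 * thetaFour t ^ 4)

/-- The product `π² θ₄⁴ (θ₃⁴ - θ₄⁴)`. -/
noncomputable def thetaN (t : ℝ) : ℝ :=
  π ^ 2 * (thetaFour t ^ 4 * (thetaThree t ^ 4 - thetaFour t ^ 4))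

lemma thetaThreeDeriv_eq {t : ℝ} (ht : 0 < t) :
    thetaThreeDeriv t = thetaLog t * thetaThree t / 2 := by
  rw [thetaLog, div_mul_cancel₀ _ (thetaThree_pos ht).ne']
  ring

lemma thetaFourDeriv_eq {t : ℝ} (ht : 0 < t) : thetaFourDeriv t =
    thetaFour t * (thetaLog t / 2 + π / 4 * (thetaThree t ^ 4 - thetaFour t ^ 4)) := by
  have h := theta_wronskian ht
  rw [thetaThreeDeriv_eq ht] at h
  refine mul_left_cancel₀ (thetaThree_pos ht).ne' ?_
  linear_combination h

/-- This is the logarithmic derivative of the first doubling formula, with θ₄' eliminated by the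
Wronskian. -/
lemma thetaLog_doubling {t : ℝ} (ht : 0 < t) : thetaLog (2 * t) =
    thetaLog t / 2 + π / 4 * (thetaFour t ^ 2 * (thetaThree t ^ 2 - thetaFour t ^ 2)) := by
  have e1 := thetaThree_sq_add_thetaFour_sq ht
  have e3 := thetaThree_deriv_doubling ht
  have h2 : 0 < 2 * t := mul_pos two_pos ht
  have hA := thetaThree_pos h2
  rw [thetaThreeDeriv_eq ht, thetaFourDeriv_eq ht, thetaThreeDeriv_eq h2] at e3
  refine mul_left_cancel₀ (mul_pos two_pos (pow_pos hA 2)).ne' ?_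
  linear_combination -e3 + (thetaLog t / 2 +
    π / 4 * (thetaFour t ^ 2 * (thetaThree t ^ 2 - thetaFour t ^ 2))) * e1

/-- The derivative of `thetaLog`. -/
noncomputable def thetaLogDeriv (t : ℝ) : ℝ :=
  2 * thetaThreeDeriv₂ t / thetaThree t - thetaLog t ^ 2 / 2

lemma hasDerivAt_thetaLog_aux {t : ℝ} (ht : 0 < t) :
    HasDerivAt thetaLog (thetaLogDeriv t) t := by
  refine (((hasDerivAt_thetaThreeDeriv ht).const_mul 2).div (hasDerivAt_thetaThree ht)
    (thetaThree_pos ht).ne').congr_deriv ?_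
  rw [thetaLogDeriv, thetaLog]
  have := (thetaThree_pos ht).ne'
  field_simp

lemma hasDerivAt_thetaThree' {t : ℝ} (ht : 0 < t) :
    HasDerivAt thetaThree (thetaLog t * thetaThree t / 2) t :=
  thetaThreeDeriv_eq ht ▸ hasDerivAt_thetaThree ht

lemma hasDerivAt_thetaFour' {t : ℝ} (ht : 0 < t) : HasDerivAt thetaFour
    (thetaFour t * (thetaLog t / 2 + π / 4 * (thetaThree t ^ 4 - thetaFour t ^ 4))) t :=
  thetaFourDeriv_eq ht ▸ hasDerivAt_thetaFour ht

/-- Differentiating `thetaLog_doubling` shows that the defect D = L' - L² - N/4 satisfies 4D(2t) =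
D(t): the function t²D(t) is invariant under doubling. -/
lemma thetaLogDeriv_doubling {t : ℝ} (ht : 0 < t) :
    4 * (thetaLogDeriv (2 * t) - thetaLog (2 * t) ^ 2 - thetaN (2 * t) / 4) =
      thetaLogDeriv t - thetaLog t ^ 2 - thetaN t / 4 := by
  have h2 : 0 < 2 * t := mul_pos two_pos ht
  have h := eq_deriv_of_eqOn_Ioi ht (fun s hs => thetaLog_doubling hs)
    (hasDerivAt_comp_two_mul (hasDerivAt_thetaLog_aux h2))
    (((hasDerivAt_thetaLog_aux ht).div_const 2).add
      ((((hasDerivAt_thetaFour' ht).pow 2).mul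
        (((hasDerivAt_thetaThree' ht).pow 2).sub ((hasDerivAt_thetaFour' ht).pow 2))).const_mul
          (π / 4)))
  have e1 := thetaThree_sq_add_thetaFour_sq ht
  have e2 := thetaThree_mul_thetaFour ht
  have q : 4 * thetaThree (2 * t) ^ 4 = (thetaThree t ^ 2 + thetaFour t ^ 2) ^ 2 := by
    rw [e1]; ring
  have r : thetaFour (2 * t) ^ 4 = (thetaThree t * thetaFour t) ^ 2 := by rw [e2]; ring
  have hN : 4 * thetaN (2 * t) = π ^ 2 * ((thetaThree t * thetaFour t) ^ 2 *
      ((thetaThree t ^ 2 + thetaFour t ^ 2) ^ 2 - 4 * (thetaThree t * thetaFour t) ^ 2)) := by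
    rw [thetaN, ← q, ← r]; ring
  have hX := thetaLog_doubling ht
  simp only [Pi.pow_apply, Pi.sub_apply] at h
  push_cast at h
  have hNt : thetaN t = π ^ 2 * (thetaFour t ^ 4 * (thetaThree t ^ 4 - thetaFour t ^ 4)) := rfl
  rw [hX]
  linear_combination 2 * h - hN / 4 + hNt / 4

lemma tendsto_sq_mul_exp_neg : Tendsto (fun t => t ^ 2 * exp (-π * t)) atTop (𝓝 0) := by
  have := tendsto_rpow_mul_exp_neg_mul_atTop_nhds_zero 2 π pi_pos
  exact this.congr fun t => by norm_num

/-- The doubling-invariant function t²D(t) tends to 0 at infinity, so D vanishes. For the limit, D =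
o(exp(-πt)) is more than enough. -/
lemma thetaLogDeriv_eq {t : ℝ} (ht : 0 < t) :
    thetaLogDeriv t = thetaLog t ^ 2 + thetaN t / 4 := by
  set D : ℝ → ℝ := fun t => thetaLogDeriv t - thetaLog t ^ 2 - thetaN t / 4 with hD
  have hconst : ∀ n : ℕ, (2 ^ n * t) ^ 2 * D (2 ^ n * t) = t ^ 2 * D t := by
    intro n
    induction n with
    | zero => simp
    | succ n ih =>
      have h := thetaLogDeriv_doubling (t := 2 ^ n * t) (by positivity)
      rw [← ih, pow_succ' 2 n, mul_assoc 2]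
      simp only [hD]
      linear_combination (2 ^ n * t) ^ 2 * h
  have hexp : Tendsto (fun t => exp (π * t) * D t) atTop (𝓝 0) := by
    have h0 : Tendsto thetaThreeDeriv atTop (𝓝 0) := by
      have h : Tendsto (fun t => exp (-(π * t))) atTop (𝓝 0) :=
        tendsto_exp_neg_atTop_nhds_zero.comp (tendsto_id.const_mul_atTop pi_pos)
      have := h.mul tendsto_exp_mul_thetaThreeDeriv
      rw [zero_mul] at this
      refine this.congr fun t => ?_
      rw [← mul_assoc, ← exp_add]
      simp
    -- Here D = 2θ₃''/θ₃ - 6(θ₃'/θ₃)² - N/4. After scaling by exp(πt), the first and last terms tend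
    -- to 4π² and -4π², and the middle one to 0.
    have h := (((tendsto_exp_mul_thetaThreeDeriv₂.const_mul 2).div tendsto_thetaThree_atTop
      one_ne_zero).sub (((tendsto_exp_mul_thetaThreeDeriv.mul h0).const_mul 6).div
        (tendsto_thetaThree_atTop.pow 2) (by norm_num))).sub
        (((tendsto_thetaFour_atTop.pow 4).mul tendsto_exp_mul_thetaThree_pow_four_sub).const_mul
          (π ^ 2 / 4))
    rw [show 2 * (2 * π ^ 2) / 1 - 6 * (-2 * π * 0) / 1 ^ 2 - π ^ 2 / 4 * (1 ^ 4 * 16) = 0 by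
      ring] at h
    refine h.congr' ?_
    filter_upwards [eventually_gt_atTop 0] with t ht
    have := (thetaThree_pos ht).ne'
    simp only [hD, thetaLogDeriv, thetaLog, thetaN, Pi.div_apply]
    field_simp
    ring
  have hlim : Tendsto (fun t => t ^ 2 * D t) atTop (𝓝 0) := by
    have := tendsto_sq_mul_exp_neg.mul hexp
    rw [zero_mul] at this
    refine this.congr fun t => ?_
    have : exp (-π * t) * exp (π * t) = 1 := by rw [← exp_add]; simp
    linear_combination t ^ 2 * D t * this
  have := tendsto_nhds_unique (tendsto_const_nhds.congr fun n => (hconst n).symm)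
    (hlim.comp (tendsto_two_pow_mul_atTop ht))
  have := (mul_eq_zero.1 this).resolve_left (pow_pos ht 2).ne'
  simp only [hD] at this
  linarith

lemma hasDerivAt_thetaLog {t : ℝ} (ht : 0 < t) :
    HasDerivAt thetaLog (thetaLog t ^ 2 + thetaN t / 4) t :=
  thetaLogDeriv_eq ht ▸ hasDerivAt_thetaLog_aux ht

lemma hasDerivAt_thetaE {t : ℝ} (ht : 0 < t) :
    HasDerivAt thetaE (2 * thetaE t * thetaLog t - 2 * thetaN t) t := by
  refine ((((hasDerivAt_thetaThree' ht).pow 4).sub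
    (((hasDerivAt_thetaFour' ht).pow 4).const_mul 2)).const_mul π).congr_deriv ?_
  rw [thetaE, thetaN]
  push_cast
  ring

lemma hasDerivAt_thetaN {t : ℝ} (ht : 0 < t) :
    HasDerivAt thetaN (4 * thetaN t * thetaLog t + thetaN t * thetaE t) t := by
  refine ((((hasDerivAt_thetaFour' ht).pow 4).mul (((hasDerivAt_thetaThree' ht).pow 4).sub
    ((hasDerivAt_thetaFour' ht).pow 4))).const_mul (π ^ 2)).congr_deriv ?_
  simp only [Pi.pow_apply, Pi.sub_apply]
  rw [thetaE, thetaN]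
  push_cast
  ring

/-- Differentiating the inversion formula at its fixed point t = 1 gives -θ₃' = θ₃/2 + θ₃'. -/
lemma thetaLog_one : thetaLog 1 = -1 / 2 := by
  have h := eq_deriv_of_eqOn_Ioi one_pos (fun s hs => thetaThree_inv hs)
    (HasDerivAt.comp (1 : ℝ) (hasDerivAt_thetaThree' (t := (1 : ℝ)⁻¹) (by norm_num))
      (hasDerivAt_inv one_ne_zero))
    ((Real.hasDerivAt_sqrt one_ne_zero).mul (hasDerivAt_thetaThree' one_pos))
  norm_num at h
  have h3 := thetaThree_pos one_pos
  refine mul_left_cancel₀ h3.ne' ?_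
  linarith

lemma thetaE_one : thetaE 1 = 0 := by
  rw [thetaE, two_mul_thetaFour_one_pow_four, sub_self, mul_zero]

lemma thetaN_one : thetaN 1 = π ^ 2 * thetaThree 1 ^ 8 / 4 := by
  rw [thetaN, show thetaFour 1 ^ 4 = thetaThree 1 ^ 4 / 2 by
    linarith [two_mul_thetaFour_one_pow_four]]
  ring

/-! ### Gauss's arithmetic-geometric mean and the value of θ₃ at 1. -/

/-- Gauss's elliptic integral `∫₀^∞ ds / √((s² + a²) (s² + b²))`. -/
noncomputable def agmIntegral (a b : ℝ) : ℝ :=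
  ∫ s in Ioi (0 : ℝ), (√((s ^ 2 + a ^ 2) * (s ^ 2 + b ^ 2)))⁻¹

lemma agmIntegral_univ (a b : ℝ) :
    ∫ s : ℝ, (√((s ^ 2 + a ^ 2) * (s ^ 2 + b ^ 2)))⁻¹ = 2 * agmIntegral a b := by
  rw [agmIntegral, ← integral_comp_abs]
  simp_rw [sq_abs]

lemma image_sub_div_Ioi {c : ℝ} (hc : 0 < c) :
    (fun s : ℝ => (s - c / s) / 2) '' Ioi 0 = univ := by
  refine eq_univ_of_forall fun u => ?_
  have h1 : √(u ^ 2 + c) ^ 2 = u ^ 2 + c := sq_sqrt (by positivity)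
  have h2 : 0 < u + √(u ^ 2 + c) := by
    have : |u| < √(u ^ 2 + c) := by
      rw [← sqrt_sq_eq_abs]
      exact sqrt_lt_sqrt (sq_nonneg u) (by linarith)
    linarith [neg_abs_le u]
  -- The witness is the positive root of s² - 2us - c = 0.
  refine ⟨u + √(u ^ 2 + c), h2, ?_⟩
  have := h2.ne'
  simp only
  field_simp
  linear_combination h1

/-- Gauss's invariance, in Newman's form: u = (s - ab/s)/2 maps (0, ∞) bijectively onto ℝ, and the
Jacobian absorbs the change in the quartic. The integral over ℝ is twice the half-line one, as the
integrand is even. -/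
lemma agmIntegral_agm {a b g : ℝ} (ha : 0 < a) (hb : 0 < b) (hg : g ^ 2 = a * b) :
    agmIntegral ((a + b) / 2) g = agmIntegral a b := by
  have hab : 0 < a * b := mul_pos ha hb
  have h := integral_image_eq_integral_abs_deriv_smul
    (f := fun s : ℝ => (s - a * b / s) / 2) (f' := fun s => (1 + a * b / s ^ 2) / 2)
    measurableSet_Ioi (s := Ioi 0) (fun s hs => ?_) ?_
    (fun s => (√((s ^ 2 + ((a + b) / 2) ^ 2) * (s ^ 2 + g ^ 2)))⁻¹)
  · rw [image_sub_div_Ioi hab, setIntegral_univ, agmIntegral_univ] at h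
    have h2 : 2 * agmIntegral ((a + b) / 2) g = 2 * agmIntegral a b := by
      rw [h, agmIntegral, ← integral_const_mul]
      refine setIntegral_congr_fun measurableSet_Ioi fun s (hs : 0 < s) => ?_
      simp only [smul_eq_mul]
      have hq : 0 < (s ^ 2 + a * b) / (4 * s ^ 2) := by positivity
      have e : (((s - a * b / s) / 2) ^ 2 + ((a + b) / 2) ^ 2) *
          (((s - a * b / s) / 2) ^ 2 + g ^ 2) =
          ((s ^ 2 + a * b) / (4 * s ^ 2)) ^ 2 * ((s ^ 2 + a ^ 2) * (s ^ 2 + b ^ 2)) := by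
        rw [hg]
        field_simp
        ring
      rw [e, sqrt_mul (sq_nonneg _), sqrt_sq hq.le, mul_inv, abs_of_pos (by positivity), ← mul_assoc]
      congr 1
      field_simp
      ring
    linarith
  · have hs0 : s ≠ 0 := ne_of_gt hs
    refine HasDerivAt.hasDerivWithinAt ((((hasDerivAt_id s).sub
      ((hasDerivAt_inv hs0).const_mul (a * b))).div_const 2).congr_deriv ?_)
    field_simp
    ring
  · intro s hs r hr hsr
    have hs : 0 < s := hs
    have hr : 0 < r := hr
    simp only at hsr
    have h1 : (s - r) * (1 + a * b / (s * r)) = 0 := by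
      have h2 : s - a * b / s - (r - a * b / r) = 0 := by linarith
      rw [← h2]
      field_simp
      ring
    have h3 : 0 < 1 + a * b / (s * r) := by positivity
    exact sub_eq_zero.1 ((mul_eq_zero.1 h1).resolve_right h3.ne')

lemma integral_Ioi_inv_sq_add_sq {a : ℝ} (ha : 0 < a) :
    ∫ s in Ioi (0 : ℝ), (s ^ 2 + a ^ 2)⁻¹ = π / (2 * a) := by
  have h := integral_comp_mul_left_Ioi (fun x : ℝ => (1 + x ^ 2)⁻¹) 0 (inv_pos.2 ha)
  rw [mul_zero, integral_Ioi_inv_one_add_sq, arctan_zero, sub_zero, inv_inv, smul_eq_mul] at h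
  have h2 : ∫ s in Ioi (0 : ℝ), (s ^ 2 + a ^ 2)⁻¹ =
      ∫ s in Ioi (0 : ℝ), (a ^ 2)⁻¹ * (1 + (a⁻¹ * s) ^ 2)⁻¹ := by
    refine setIntegral_congr_fun measurableSet_Ioi fun s _ => ?_
    rw [← mul_inv]
    congr 1
    field_simp
    ring
  rw [h2, integral_const_mul, h]
  field_simp

lemma integrableOn_inv_sq_add_sq {a : ℝ} (ha : 0 < a) :
    IntegrableOn (fun s : ℝ => (s ^ 2 + a ^ 2)⁻¹) (Ioi 0) := by
  -- The Bochner integral of a non-integrable function is 0, whereas the value computed above is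
  -- positive.
  by_contra h
  have := integral_Ioi_inv_sq_add_sq ha
  rw [integral_undef h] at this
  have h2 : 0 < π / (2 * a) := by positivity
  linarith

lemma sqrt_mul_le_of_le {a b s : ℝ} (hb : 0 ≤ b) (hab : b ≤ a) :
    √((s ^ 2 + a ^ 2) * (s ^ 2 + b ^ 2)) ≤ s ^ 2 + a ^ 2 := by
  refine sqrt_le_iff.2 ⟨by positivity, ?_⟩
  rw [sq (s ^ 2 + a ^ 2)]
  gcongr

lemma le_sqrt_mul_of_le {a b s : ℝ} (hb : 0 ≤ b) (hab : b ≤ a) :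
    s ^ 2 + b ^ 2 ≤ √((s ^ 2 + a ^ 2) * (s ^ 2 + b ^ 2)) := by
  refine le_sqrt_of_sq_le ?_
  rw [sq (s ^ 2 + b ^ 2)]
  gcongr

lemma integrableOn_agmIntegral {a b : ℝ} (hb : 0 < b) (hab : b ≤ a) :
    IntegrableOn (fun s : ℝ => (√((s ^ 2 + a ^ 2) * (s ^ 2 + b ^ 2)))⁻¹) (Ioi 0) := by
  refine (integrableOn_inv_sq_add_sq hb).mono' ?_ (ae_of_all _ fun s => ?_)
  · exact (by fun_prop : Measurable _).aestronglyMeasurable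
  · rw [norm_of_nonneg (by positivity)]
    exact inv_anti₀ (by positivity) (le_sqrt_mul_of_le hb.le hab)

lemma agmIntegral_le {a b : ℝ} (hb : 0 < b) (hab : b ≤ a) : agmIntegral a b ≤ π / (2 * b) := by
  rw [← integral_Ioi_inv_sq_add_sq hb]
  exact setIntegral_mono (integrableOn_agmIntegral hb hab) (integrableOn_inv_sq_add_sq hb)
    fun s => inv_anti₀ (by positivity) (le_sqrt_mul_of_le hb.le hab)

lemma le_agmIntegral {a b : ℝ} (hb : 0 < b) (hab : b ≤ a) : π / (2 * a) ≤ agmIntegral a b := by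
  have ha := hb.trans_le hab
  rw [← integral_Ioi_inv_sq_add_sq ha]
  exact setIntegral_mono (integrableOn_inv_sq_add_sq ha) (integrableOn_agmIntegral hb hab)
    fun s => inv_anti₀ (by positivity) (sqrt_mul_le_of_le hb.le hab)

lemma agmIntegral_mul {a b c : ℝ} (hc : 0 < c) :
    agmIntegral (c * a) (c * b) = agmIntegral a b / c := by
  have h := integral_comp_mul_left_Ioi
    (fun s : ℝ => (√((s ^ 2 + (c * a) ^ 2) * (s ^ 2 + (c * b) ^ 2)))⁻¹) 0 hc
  rw [mul_zero, smul_eq_mul] at h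
  have h2 : agmIntegral (c * a) (c * b) = c * (∫ s in Ioi (0 : ℝ),
      (√(((c * s) ^ 2 + (c * a) ^ 2) * ((c * s) ^ 2 + (c * b) ^ 2)))⁻¹) := by
    rw [h, agmIntegral]
    field_simp
  rw [h2, agmIntegral, ← integral_const_mul, ← integral_div]
  refine setIntegral_congr_fun measurableSet_Ioi fun s _ => ?_
  rw [show ((c * s) ^ 2 + (c * a) ^ 2) * ((c * s) ^ 2 + (c * b) ^ 2) =
    (c ^ 2) ^ 2 * ((s ^ 2 + a ^ 2) * (s ^ 2 + b ^ 2)) by ring, sqrt_mul (by positivity),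
    sqrt_sq (by positivity)]
  field_simp

/-- Passing from t to 2t replaces (θ₃², θ₄²) by its arithmetic and geometric means. The integral is
therefore constant along 2ⁿt, where it is squeezed between π/(2θ₃²) and π/(2θ₄²); both tend to π/2.
-/
lemma agmIntegral_theta {t : ℝ} (ht : 0 < t) :
    agmIntegral (thetaThree t ^ 2) (thetaFour t ^ 2) = π / 2 := by
  have hstep : ∀ n : ℕ, agmIntegral (thetaThree (2 ^ n * t) ^ 2) (thetaFour (2 ^ n * t) ^ 2) =
      agmIntegral (thetaThree t ^ 2) (thetaFour t ^ 2) := by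
    intro n
    induction n with
    | zero => simp
    | succ n ih =>
      have h : 0 < 2 ^ n * t := by positivity
      rw [← ih, pow_succ' 2 n, mul_assoc 2, ← thetaThree_mul_thetaFour h,
        ← agmIntegral_agm (pow_pos (thetaThree_pos h) 2) (pow_pos (thetaFour_pos h) 2)
          (mul_pow (thetaThree (2 ^ n * t)) (thetaFour (2 ^ n * t)) 2),
        thetaThree_sq_add_thetaFour_sq h, mul_div_cancel_left₀ _ two_ne_zero]
  have h1 : Tendsto (fun t => π / (2 * thetaThree t ^ 2)) atTop (𝓝 (π / 2)) := by
    simpa using! tendsto_const_nhds.div ((tendsto_thetaThree_atTop.pow 2).const_mul 2)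
      (by norm_num) (a := π)
  have h2 : Tendsto (fun t => π / (2 * thetaFour t ^ 2)) atTop (𝓝 (π / 2)) := by
    simpa using! tendsto_const_nhds.div ((tendsto_thetaFour_atTop.pow 2).const_mul 2)
      (by norm_num) (a := π)
  have h3 := tendsto_two_pow_mul_atTop ht
  refine le_antisymm (ge_of_tendsto' (h2.comp h3) fun n => ?_)
    (le_of_tendsto' (h1.comp h3) fun n => ?_) <;> rw [← hstep n]
  · exact agmIntegral_le (pow_pos (thetaFour_pos (by positivity)) 2)
      (thetaFour_sq_lt_thetaThree_sq (by positivity)).le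
  · exact le_agmIntegral (pow_pos (thetaFour_pos (by positivity)) 2)
      (thetaFour_sq_lt_thetaThree_sq (by positivity)).le

/-- This is the normalization of the Beta probability density. -/
lemma integral_Ioo_beta {α β : ℝ} (hα : 0 < α) (hβ : 0 < β) :
    ∫ x in Ioo (0 : ℝ) 1, x ^ (α - 1) * (1 - x) ^ (β - 1) = ProbabilityTheory.beta α β := by
  have h := ProbabilityTheory.lintegral_betaPDF_eq_one hα hβ
  have hpos := ProbabilityTheory.beta_pos hα hβ
  rw [ProbabilityTheory.lintegral_betaPDF, ← ENNReal.toReal_eq_one_iff,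
    ← integral_eq_lintegral_of_nonneg_ae] at h
  · simp_rw [mul_assoc, integral_const_mul] at h
    field_simp at h
    exact h
  · refine ae_restrict_of_forall_mem measurableSet_Ioo fun x hx => ?_
    have := rpow_nonneg hx.1.le (α - 1)
    have := rpow_nonneg (sub_nonneg.2 hx.2.le) (β - 1)
    simp only [Pi.zero_apply]
    positivity
  · exact (by fun_prop : Measurable _).aestronglyMeasurable

lemma image_inv_one_add_sq_sq_Ioi :
    (fun s : ℝ => ((1 + s ^ 2) ^ 2)⁻¹) '' Ioi 0 = Ioo 0 1 := by
  ext w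
  constructor
  · rintro ⟨s, hs, rfl⟩
    have hs : 0 < s := hs
    refine ⟨by positivity, inv_lt_one_of_one_lt₀ ?_⟩
    nlinarith [pow_pos hs 2]
  · rintro ⟨h0, h1⟩
    have hw : 1 < √w⁻¹ := by
      rw [← sqrt_one]
      exact sqrt_lt_sqrt zero_le_one ((one_lt_inv₀ h0).2 h1)
    refine ⟨√(√w⁻¹ - 1), sqrt_pos.2 (sub_pos.2 hw), ?_⟩
    simp only
    rw [sq_sqrt (sub_pos.2 hw).le, add_sub_cancel, sq_sqrt (inv_pos.2 h0).le, inv_inv]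

/-- The substitution x = (1 + s²)⁻² turns the elliptic integral into a Beta integral. -/
lemma agmIntegral_sqrt_two_one :
    agmIntegral √2 1 = ProbabilityTheory.beta (1 / 4) (1 / 2) / 4 := by
  rw [← integral_Ioo_beta (by norm_num) (by norm_num), ← image_inv_one_add_sq_sq_Ioi]
  rw [integral_image_eq_integral_abs_deriv_smul (f' := fun s : ℝ => -(4 * s) / (1 + s ^ 2) ^ 3)
    measurableSet_Ioi, agmIntegral, ← integral_div]
  · refine setIntegral_congr_fun measurableSet_Ioi fun s (hs : 0 < s) => ?_
    simp only [smul_eq_mul]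
    set q := √(1 + s ^ 2) with hq
    have hq0 : 0 < q := sqrt_pos.2 (by positivity)
    have hq2 : 1 + s ^ 2 = q ^ 2 := (sq_sqrt (by positivity)).symm
    have e1 : (((1 + s ^ 2) ^ 2)⁻¹ : ℝ) ^ ((1 / 4 : ℝ) - 1) = q ^ 3 := by
      rw [hq2, ← pow_mul, ← rpow_natCast, ← rpow_neg hq0.le, ← rpow_mul hq0.le,
        ← rpow_natCast q 3]
      norm_num
    have e2 : (1 - ((1 + s ^ 2) ^ 2)⁻¹ : ℝ) ^ ((1 / 2 : ℝ) - 1) =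
        (1 + s ^ 2) / (s * √(s ^ 2 + 2)) := by
      rw [show (1 / 2 : ℝ) - 1 = -(1 / 2) by norm_num, rpow_neg, ← sqrt_eq_rpow,
        show (1 - ((1 + s ^ 2) ^ 2)⁻¹ : ℝ) = (s / (1 + s ^ 2)) ^ 2 * (s ^ 2 + 2) by
          field_simp; ring, sqrt_mul (by positivity), sqrt_sq (by positivity)]
      · field_simp
      · rw [sub_nonneg]
        refine inv_le_one_of_one_le₀ ?_
        nlinarith [pow_pos hs 2]
    have hr : 0 < √(s ^ 2 + 2) := sqrt_pos.2 (by positivity)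
    rw [e1, e2, sq_sqrt two_pos.le, one_pow, neg_div, abs_neg, abs_of_pos (by positivity),
      add_comm (s ^ 2) 1, sqrt_mul (by positivity), ← hq]
    rw [hq2]
    field_simp
  · intro s _
    refine HasDerivAt.hasDerivWithinAt ?_
    have h : (1 + s ^ 2) ^ 2 ≠ 0 := by positivity
    refine ((((hasDerivAt_pow 2 s).const_add 1).pow 2).inv h).congr_deriv ?_
    simp only [Pi.pow_apply]
    field_simp
    push_cast
    ring
  · intro s hs r hr h
    have hs : 0 < s := hs
    have hr : 0 < r := hr
    simp only [inv_inj] at h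
    have h1 := (pow_left_inj₀ (by positivity) (by positivity) two_ne_zero).1 h
    exact (pow_left_inj₀ hs.le hr.le two_ne_zero).1 (add_left_cancel h1)

lemma Gamma_quarter_mul : Gamma (1 / 4) * Gamma (3 / 4) = π * √2 := by
  have h := Gamma_mul_Gamma_one_sub (1 / 4)
  rw [show (1 : ℝ) - 1 / 4 = 3 / 4 by norm_num, show π * (1 / 4) = π / 4 by ring,
    sin_pi_div_four] at h
  rw [h, div_div_eq_mul_div, mul_div_assoc]
  congr 1
  rw [div_eq_iff (by positivity), mul_self_sqrt two_pos.le]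

/-- At t = 1 the pair (θ₃², θ₄²) is θ₄² times (√2, 1). By homogeneity, π/2 = B(1/4, 1/2)/(4θ₄²), and
the reflection formula trades Γ(1/4) for Γ(3/4). -/
lemma thetaThree_one : thetaThree 1 = π ^ (1 / 4 : ℝ) / Gamma (3 / 4) := by
  have hG : 0 < Gamma (3 / 4) := Gamma_pos_of_pos (by norm_num)
  have h4 := two_mul_thetaFour_one_pow_four
  have hb := thetaFour_pos one_pos
  have ha := thetaThree_pos one_pos
  have hx : thetaThree 1 ^ 2 = thetaFour 1 ^ 2 * √2 := by
    rw [← pow_left_inj₀ (by positivity) (by positivity) two_ne_zero, mul_pow, sq_sqrt two_pos.le]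
    linear_combination -h4
  have h := agmIntegral_theta one_pos
  have hJ := agmIntegral_mul (a := √2) (b := 1) (pow_pos hb 2)
  rw [mul_one, ← hx, h, agmIntegral_sqrt_two_one, ProbabilityTheory.beta,
    Gamma_one_half_eq, show (1 / 4 + 1 / 2 : ℝ) = 3 / 4 by norm_num] at hJ
  have hg := Gamma_quarter_mul
  have hg' : Gamma (1 / 4) = π * √2 / Gamma (3 / 4) := by rw [← hg]; field_simp
  rw [hg'] at hJ
  have hpi := pi_pos
  field_simp at hJ
  have hs2 : √2 ^ 2 = 2 := sq_sqrt two_pos.le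
  have hsp : √π ^ 2 = π := sq_sqrt pi_pos.le
  have key : thetaThree 1 ^ 4 * Gamma (3 / 4) ^ 4 = π := by
    have : (thetaFour 1 ^ 2 * Gamma (3 / 4) ^ 2 * 2) ^ 2 = (√2 * √π) ^ 2 := by
      congr 1
      linarith
    rw [mul_pow √2, hs2, hsp] at this
    rw [← h4]
    linarith
  rw [eq_div_iff hG.ne', ← pow_left_inj₀ (by positivity) (by positivity) four_ne_zero, mul_pow, key,
    ← rpow_natCast, ← rpow_mul hpi.le]
  norm_num

/-! ### Derivatives of θ₃ at 1 and the seven sums. -/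

/-- The `n`-th derivative of `θ₃ · thetaLog ^ i · thetaE ^ j · thetaN ^ l`. -/
noncomputable def thetaJet : ℕ → ℕ → ℕ → ℕ → ℝ → ℝ
  | 0, i, j, l, t => thetaThree t * (thetaLog t ^ i * thetaE t ^ j * thetaN t ^ l)
  | n + 1, i, j, l, t => (i + 2 * j + 4 * l + 1 / 2) * thetaJet n (i + 1) j l t +
      i / 4 * thetaJet n (i - 1) j (l + 1) t - 2 * j * thetaJet n i (j - 1) (l + 1) t +
      l * thetaJet n i (j + 1) l t

lemma hasDerivAt_thetaJet (n i j l : ℕ) {t : ℝ} (ht : 0 < t) :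
    HasDerivAt (thetaJet n i j l) (thetaJet (n + 1) i j l t) t := by
  induction n generalizing i j l with
  | zero =>
    refine ((hasDerivAt_thetaThree' ht).mul ((((hasDerivAt_thetaLog ht).pow i).mul
      ((hasDerivAt_thetaE ht).pow j)).mul ((hasDerivAt_thetaN ht).pow l))).congr_deriv ?_
    simp only [thetaJet, Pi.mul_apply, Pi.pow_apply]
    -- Separating zero exponents handles the truncated subtractions i - 1 and j - 1, whose
    -- coefficients vanish there.
    rcases i with _ | i <;> rcases j with _ | j <;> rcases l with _ | l <;>
      simp only [Nat.add_sub_cancel, Nat.zero_sub] <;> push_cast <;> ring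
  | succ n ih =>
    exact (((((ih (i + 1) j l).const_mul _).add ((ih (i - 1) j (l + 1)).const_mul _)).sub
      ((ih i (j - 1) (l + 1)).const_mul _)).add ((ih i (j + 1) l).const_mul _))

lemma thetaSeries_one_eq_thetaJet (k : ℕ) {t : ℝ} (ht : 0 < t) :
    (-π) ^ k * thetaSeries (fun _ => 1) k t = thetaJet k 0 0 0 t := by
  induction k generalizing t with
  | zero => simp [thetaJet, thetaThree]
  | succ k ih =>
    have := eq_deriv_of_eqOn_Ioi ht (fun s hs => ih hs)
      ((hasDerivAt_thetaSeries abs_one_le k ht).const_mul ((-π) ^ k)) (hasDerivAt_thetaJet k 0 0 0 ht)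
    rw [← this]
    ring

/-- Quarter-integer powers of π become natural powers of p = π^(1/4), so the closing verifications
are identities of rational functions in p and Γ(3/4). -/
lemma pi_rpow_eq_pow {a : ℝ} (m : ℕ) (h : a = m / 4) : π ^ a = (π ^ (1 / 4 : ℝ)) ^ m := by
  rw [← rpow_natCast, ← rpow_mul pi_pos.le, h]
  congr 1
  ring

lemma pi_eq_pow : π = (π ^ (1 / 4 : ℝ)) ^ 4 := by
  rw [← pi_rpow_eq_pow (a := 1) 4 (by norm_num), rpow_one]

lemma thetaJet_zero_one (i j l : ℕ) : thetaJet 0 i j l 1 = π ^ (1 / 4 : ℝ) / Gamma (3 / 4) *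
    ((-1 / 2) ^ i * 0 ^ j * ((π ^ (1 / 4 : ℝ)) ^ 16 / (4 * Gamma (3 / 4) ^ 8)) ^ l) := by
  rw [thetaJet, thetaLog_one, thetaE_one, thetaN_one, thetaThree_one]
  have hpi := pi_eq_pow
  generalize π ^ (1 / 4 : ℝ) = p at hpi ⊢
  rw [hpi]
  ring

/-- The series over ℤ is even, and k ≠ 0 removes its central term. -/
lemma hasSum_pnat_pow_mul_exp {k : ℕ} (hk : k ≠ 0) :
    HasSum (fun n : ℕ+ => (n : ℝ) ^ (2 * k) * exp (-π * (n : ℝ) ^ 2))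
      (thetaSeries (fun _ => 1) k 1 / 2) := by
  have hs := summable_thetaSeries abs_one_le k one_pos
  have hsum : Summable fun n : ℕ+ => (n : ℝ) ^ (2 * k) * exp (-π * (n : ℝ) ^ 2) := by
    have h : Function.Injective fun n : ℕ+ => (n : ℤ) := fun a b h => by
      exact PNat.coe_injective (Int.ofNat_injective h)
    refine (hs.comp_injective h).congr fun n => ?_
    simp
  have := tsum_int_eq_zero_add_two_mul_tsum_pnat (fun n => by simp [pow_mul]) hs
  rw [thetaSeries, this]
  simp only [one_mul, mul_one, Int.cast_zero, Int.cast_natCast]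
  rw [zero_pow (by simpa using hk), zero_mul, zero_add, two_nsmul, add_self_div_two]
  exact hsum.hasSum


lemma thetaJet_succ (n i j l : ℕ) (t : ℝ) : thetaJet (n + 1) i j l t =
    (i + 2 * j + 4 * l + 1 / 2) * thetaJet n (i + 1) j l t +
      i / 4 * thetaJet n (i - 1) j (l + 1) t - 2 * j * thetaJet n i (j - 1) (l + 1) t +
      l * thetaJet n i (j + 1) l t := rfl

/-- The value at `1` of the `k`-th derivative of `thetaThree`, for `p = π ^ (1/4)`, `g = Γ(3/4)`. -/
noncomputable def thetaThreeValue (p g : ℝ) : ℕ → ℝ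
  | 0 => 1 * (p / g)
  | 1 => -1 / 4 * (p / g)
  | 2 => 3 / 16 * (p / g) + 1 / 32 * (p ^ 17 / g ^ 9)
  | 3 => -15 / 64 * (p / g) - 15 / 128 * (p ^ 17 / g ^ 9)
  | 4 => 105 / 256 * (p / g) + 105 / 256 * (p ^ 17 / g ^ 9) - 1 / 1024 * (p ^ 33 / g ^ 17)
  | 5 => -945 / 1024 * (p / g) - 1575 / 1024 * (p ^ 17 / g ^ 9) + 45 / 4096 * (p ^ 33 / g ^ 17)
  | 6 => 10395 / 4096 * (p / g) + 51975 / 8192 * (p ^ 17 / g ^ 9)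
      - 1485 / 16384 * (p ^ 33 / g ^ 17) + 51 / 32768 * (p ^ 49 / g ^ 25)
  | 7 => -135135 / 16384 * (p / g) - 945945 / 32768 * (p ^ 17 / g ^ 9)
      + 45045 / 65536 * (p ^ 33 / g ^ 17) - 4641 / 131072 * (p ^ 49 / g ^ 25)
  | _ => 0

lemma thetaJet_eq_value {k : ℕ} (hk : k < 8) :
    thetaJet k 0 0 0 1 = thetaThreeValue (π ^ (1 / 4 : ℝ)) (Gamma (3 / 4)) k := by
  interval_cases k <;> simp [thetaJet_succ, thetaJet_zero_one, thetaThreeValue] <;> ring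

lemma thetaSeries_one_eq_value {k : ℕ} (hk : k < 8) : thetaSeries (fun _ => 1) k 1 =
    thetaThreeValue (π ^ (1 / 4 : ℝ)) (Gamma (3 / 4)) k / (-π) ^ k := by
  rw [eq_div_iff (pow_ne_zero _ (neg_ne_zero.2 pi_ne_zero)), ← thetaJet_eq_value hk,
    ← thetaSeries_one_eq_thetaJet k one_pos, mul_comm]

lemma hasSum_pnat_pow_2 :
    HasSum (fun n : ℕ+ => -(n : ℝ) ^ 2 * exp (-π * (n : ℝ) ^ 2))
      (-1 / (8 * π ^ (3 / 4 : ℝ) * Gamma (3 / 4))) := by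
  have h := ((hasSum_pnat_pow_mul_exp (k := 1) (by norm_num)).neg)
  have hG : Gamma (3 / 4) ≠ 0 := (Gamma_pos_of_pos (by norm_num)).ne'
  have hp : π ^ (1 / 4 : ℝ) ≠ 0 := (rpow_pos_of_pos pi_pos _).ne'
  rw [thetaSeries_one_eq_value (by norm_num)] at h
  convert! h using 1
  · funext n; ring
  · rw [pi_rpow_eq_pow (a := 3 / 4) 3 (by norm_num)]
    have hpi := pi_eq_pow
    generalize π ^ (1 / 4 : ℝ) = p at hp hpi ⊢
    rw [hpi, thetaThreeValue]
    field_simp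
    ring
lemma hasSum_pnat_pow_4 :
    HasSum (fun n : ℕ+ => (n : ℝ) ^ 4 * exp (-π * (n : ℝ) ^ 2))
      ((3 + π ^ 4 / (2 * Gamma (3 / 4) ^ 8)) / (32 * π ^ (7 / 4 : ℝ) * Gamma (3 / 4))) := by
  have h := (hasSum_pnat_pow_mul_exp (k := 2) (by norm_num))
  have hG : Gamma (3 / 4) ≠ 0 := (Gamma_pos_of_pos (by norm_num)).ne'
  have hp : π ^ (1 / 4 : ℝ) ≠ 0 := (rpow_pos_of_pos pi_pos _).ne'
  rw [thetaSeries_one_eq_value (by norm_num)] at h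
  convert! h using 1
  · rw [pi_rpow_eq_pow (a := 7 / 4) 7 (by norm_num)]
    have hpi := pi_eq_pow
    generalize π ^ (1 / 4 : ℝ) = p at hp hpi ⊢
    rw [hpi, thetaThreeValue]
    field_simp
    ring
lemma hasSum_pnat_pow_6 :
    HasSum (fun n : ℕ+ => -(n : ℝ) ^ 6 * exp (-π * (n : ℝ) ^ 2))
      (-15 / (128 * π ^ (11 / 4 : ℝ) * Gamma (3 / 4)) - 15 * π ^ (5 / 4 : ℝ) / (256 * Gamma (3 / 4) ^ 9)) := by
  have h := ((hasSum_pnat_pow_mul_exp (k := 3) (by norm_num)).neg)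
  have hG : Gamma (3 / 4) ≠ 0 := (Gamma_pos_of_pos (by norm_num)).ne'
  have hp : π ^ (1 / 4 : ℝ) ≠ 0 := (rpow_pos_of_pos pi_pos _).ne'
  rw [thetaSeries_one_eq_value (by norm_num)] at h
  convert! h using 1
  · funext n; ring
  · rw [pi_rpow_eq_pow (a := 5 / 4) 5 (by norm_num), pi_rpow_eq_pow (a := 11 / 4) 11 (by norm_num)]
    have hpi := pi_eq_pow
    generalize π ^ (1 / 4 : ℝ) = p at hp hpi ⊢
    rw [hpi, thetaThreeValue]
    field_simp
    ring
lemma hasSum_pnat_pow_8 :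
    HasSum (fun n : ℕ+ => (n : ℝ) ^ 8 * exp (-π * (n : ℝ) ^ 2))
      (105 / (512 * π ^ (15 / 4 : ℝ) * Gamma (3 / 4)) + 105 * π ^ (1 / 4 : ℝ) / (512 * Gamma (3 / 4) ^ 9)
        - π ^ (17 / 4 : ℝ) / (2048 * Gamma (3 / 4) ^ 17)) := by
  have h := (hasSum_pnat_pow_mul_exp (k := 4) (by norm_num))
  have hG : Gamma (3 / 4) ≠ 0 := (Gamma_pos_of_pos (by norm_num)).ne'
  have hp : π ^ (1 / 4 : ℝ) ≠ 0 := (rpow_pos_of_pos pi_pos _).ne'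
  rw [thetaSeries_one_eq_value (by norm_num)] at h
  convert! h using 1
  · rw [pi_rpow_eq_pow (a := 15 / 4) 15 (by norm_num), pi_rpow_eq_pow (a := 17 / 4) 17 (by norm_num)]
    have hpi := pi_eq_pow
    generalize π ^ (1 / 4 : ℝ) = p at hp hpi ⊢
    rw [hpi, thetaThreeValue]
    field_simp
    ring
lemma hasSum_pnat_pow_10 :
    HasSum (fun n : ℕ+ => -(n : ℝ) ^ 10 * exp (-π * (n : ℝ) ^ 2))
      (-945 / (2048 * π ^ (19 / 4 : ℝ) * Gamma (3 / 4)) - 1575 / (2048 * π ^ (3 / 4 : ℝ) * Gamma (3 / 4) ^ 9)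
        + 45 * π ^ (13 / 4 : ℝ) / (8192 * Gamma (3 / 4) ^ 17)) := by
  have h := ((hasSum_pnat_pow_mul_exp (k := 5) (by norm_num)).neg)
  have hG : Gamma (3 / 4) ≠ 0 := (Gamma_pos_of_pos (by norm_num)).ne'
  have hp : π ^ (1 / 4 : ℝ) ≠ 0 := (rpow_pos_of_pos pi_pos _).ne'
  rw [thetaSeries_one_eq_value (by norm_num)] at h
  convert! h using 1
  · funext n; ring
  · rw [pi_rpow_eq_pow (a := 3 / 4) 3 (by norm_num), pi_rpow_eq_pow (a := 13 / 4) 13 (by norm_num), pi_rpow_eq_pow (a := 19 / 4) 19 (by norm_num)]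
    have hpi := pi_eq_pow
    generalize π ^ (1 / 4 : ℝ) = p at hp hpi ⊢
    rw [hpi, thetaThreeValue]
    field_simp
    ring
lemma hasSum_pnat_pow_12 :
    HasSum (fun n : ℕ+ => (n : ℝ) ^ 12 * exp (-π * (n : ℝ) ^ 2))
      (10395 / (8192 * π ^ (23 / 4 : ℝ) * Gamma (3 / 4)) + 51975 / (16384 * π ^ (7 / 4 : ℝ) * Gamma (3 / 4) ^ 9)
        - 1485 * π ^ (9 / 4 : ℝ) / (32768 * Gamma (3 / 4) ^ 17) + 51 * π ^ (25 / 4 : ℝ) / (65536 * Gamma (3 / 4) ^ 25)) := by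
  have h := (hasSum_pnat_pow_mul_exp (k := 6) (by norm_num))
  have hG : Gamma (3 / 4) ≠ 0 := (Gamma_pos_of_pos (by norm_num)).ne'
  have hp : π ^ (1 / 4 : ℝ) ≠ 0 := (rpow_pos_of_pos pi_pos _).ne'
  rw [thetaSeries_one_eq_value (by norm_num)] at h
  convert! h using 1
  · rw [pi_rpow_eq_pow (a := 7 / 4) 7 (by norm_num), pi_rpow_eq_pow (a := 9 / 4) 9 (by norm_num), pi_rpow_eq_pow (a := 23 / 4) 23 (by norm_num), pi_rpow_eq_pow (a := 25 / 4) 25 (by norm_num)]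
    have hpi := pi_eq_pow
    generalize π ^ (1 / 4 : ℝ) = p at hp hpi ⊢
    rw [hpi, thetaThreeValue]
    field_simp
    ring
lemma hasSum_pnat_pow_14 :
    HasSum (fun n : ℕ+ => -(n : ℝ) ^ 14 * exp (-π * (n : ℝ) ^ 2))
      (-135135 / (32768 * π ^ (27 / 4 : ℝ) * Gamma (3 / 4)) - 945945 / (65536 * π ^ (11 / 4 : ℝ) * Gamma (3 / 4) ^ 9)
        + 45045 * π ^ (5 / 4 : ℝ) / (131072 * Gamma (3 / 4) ^ 17) - 4641 * π ^ (21 / 4 : ℝ) / (262144 * Gamma (3 / 4) ^ 25)) := by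
  have h := ((hasSum_pnat_pow_mul_exp (k := 7) (by norm_num)).neg)
  have hG : Gamma (3 / 4) ≠ 0 := (Gamma_pos_of_pos (by norm_num)).ne'
  have hp : π ^ (1 / 4 : ℝ) ≠ 0 := (rpow_pos_of_pos pi_pos _).ne'
  rw [thetaSeries_one_eq_value (by norm_num)] at h
  convert! h using 1
  · funext n; ring
  · rw [pi_rpow_eq_pow (a := 5 / 4) 5 (by norm_num), pi_rpow_eq_pow (a := 11 / 4) 11 (by norm_num), pi_rpow_eq_pow (a := 21 / 4) 21 (by norm_num), pi_rpow_eq_pow (a := 27 / 4) 27 (by norm_num)]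
    have hpi := pi_eq_pow
    generalize π ^ (1 / 4 : ℝ) = p at hp hpi ⊢
    rw [hpi, thetaThreeValue]
    field_simp
    ring

/-! ### The kernel in the logarithmic variable: derivatives, decay, integrability. -/

/-- The theta series `∑ n^(2k) exp (-π n² t)` over the nonzero integers. -/
noncomputable def thetaTail : ℕ → ℝ → ℝ := thetaSeries fun n => if n = 0 then 0 else 1

/-- The `n`-th derivative of `y ↦ exp ((a + i) y) * thetaTail i (exp y)`. -/
noncomputable def expJet (a : ℝ) : ℕ → ℕ → ℝ → ℝ
  | 0, i, y => exp ((a + i) * y) * thetaTail i (exp y)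
  | n + 1, i, y => (a + i) * expJet a n i y - π * expJet a n (i + 1) y

lemma hasDerivAt_expJet (a : ℝ) (n i : ℕ) (y : ℝ) :
    HasDerivAt (expJet a n i) (expJet a (n + 1) i y) y := by
  induction n generalizing i with
  | zero =>
    refine ((((hasDerivAt_id y).const_mul (a + i)).exp).mul
      ((hasDerivAt_thetaSeries (abs_ite_ne_zero_le abs_one_le) i (exp_pos y)).comp y
        (hasDerivAt_exp y))).congr_deriv ?_
    simp only [expJet, thetaTail, id, Function.comp]
    push_cast
    rw [show (a + (i + 1)) * y = (a + i) * y + y by ring, exp_add ((a + i) * y)]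
    ring
  | succ n ih => exact ((ih i).const_mul (a + i)).sub ((ih (i + 1)).const_mul π)

lemma isBigO_thetaTail (i : ℕ) : thetaTail i =O[atTop] fun t => exp (-π * t) := by
  have h := (tendsto_exp_mul_thetaSeries (abs_ite_ne_zero_le abs_one_le) i
    (Or.inl (by simp))).isBigO_one ℝ
  have h2 := (Asymptotics.isBigO_refl (fun t : ℝ => exp (-π * t)) atTop).mul h
  refine (h2.congr' (.of_eq (funext fun t => ?_)) (.of_eq (funext fun t => mul_one _)))
  rw [← mul_assoc, ← exp_add]
  simp [thetaTail]

lemma isBigO_expJet (a : ℝ) (n i : ℕ) :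
    expJet a n i =O[atTop] fun y => exp (-(1 / 2) * y) := by
  induction n generalizing i with
  | zero =>
    have h := ((isBigO_thetaTail i).trans
      -- The power of t = e^y is chosen so that, times e^((a+i)y), it gives exactly e^(-y/2), the
      -- rate of the other term of `mellinJet`.
      (isLittleO_exp_neg_mul_rpow_atTop pi_pos (-(1 / 2) - (a + i))).isBigO).comp_tendsto
        tendsto_exp_atTop
    refine ((Asymptotics.isBigO_refl (fun y : ℝ => exp ((a + i) * y)) atTop).mul h).congr
      (fun y => rfl) fun y => ?_
    simp only [Function.comp]
    rw [← exp_mul, ← exp_add]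
    congr 1
    ring
  | succ n ih => exact ((ih i).const_mul_left (a + i)).sub ((ih (i + 1)).const_mul_left π)

/-- The `n`-th derivative of `y ↦ (thetaThree (exp y) - 1 - exp (-y / 2)) / 2`. -/
noncomputable def mellinJet (n : ℕ) (y : ℝ) : ℝ :=
  expJet 0 n 0 y / 2 - (-(1 / 2)) ^ n * exp (-(1 / 2) * y) / 2

lemma thetaThree_exp_eq (y : ℝ) :
    thetaThree (exp y) = 2 * mellinJet 0 y + 1 + exp (-(1 / 2) * y) := by
  rw [mellinJet, expJet, thetaThree, thetaSeries_zero_eq_add abs_one_le (exp_pos y), thetaTail]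
  simp
  ring

lemma hasDerivAt_mellinJet (n : ℕ) (y : ℝ) :
    HasDerivAt (mellinJet n) (mellinJet (n + 1) y) y := by
  refine (((hasDerivAt_expJet 0 n 0 y).div_const 2).sub
    (((((hasDerivAt_id y).const_mul (-(1 / 2))).exp).const_mul ((-(1 / 2)) ^ n)).div_const
      2)).congr_deriv ?_
  rw [mellinJet]
  simp only [id]
  ring

/-- By the inversion formula, M tends to -1/2 at -∞ at an exponential rate. Hence M is not
integrable on ℝ, but its derivatives are. -/
lemma mellinJet_zero_eq_neg (y : ℝ) : mellinJet 0 y = expJet (1 / 2) 0 0 (-y) / 2 - 1 / 2 := by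
  have h1 := thetaThree_exp_eq y
  have h2 := thetaThree_inv (exp_pos (-y))
  rw [← exp_neg, neg_neg] at h2
  have h3 : thetaThree (exp (-y)) = 1 + thetaTail 0 (exp (-y)) := by
    rw [thetaThree, thetaSeries_zero_eq_add abs_one_le (exp_pos _), thetaTail]
  have h4 : √(exp (-y)) = exp (-(1 / 2) * y) := by
    rw [← exp_half]
    ring_nf
  have h5 : exp ((1 / 2 + (0 : ℕ)) * -y) = exp (-(1 / 2) * y) := by
    congr 1
    push_cast
    ring
  rw [h1, h3, h4] at h2
  rw [expJet, h5]
  linarith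

lemma mellinJet_succ_eq_neg (n : ℕ) (y : ℝ) :
    mellinJet (n + 1) y = (-1) ^ (n + 1) * expJet (1 / 2) (n + 1) 0 (-y) / 2 := by
  induction n generalizing y with
  | zero =>
    refine (hasDerivAt_mellinJet 0 y).unique ?_
    rw [funext mellinJet_zero_eq_neg]
    refine ((((hasDerivAt_expJet (1 / 2) 0 0 (-y)).scomp y (hasDerivAt_neg y)).div_const 2).sub_const
      (1 / 2)).congr_deriv ?_
    simp
  | succ n ih =>
    refine (hasDerivAt_mellinJet (n + 1) y).unique ?_
    rw [funext ih]
    refine ((((hasDerivAt_expJet (1 / 2) (n + 1) 0 (-y)).scomp y (hasDerivAt_neg y)).const_mul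
      ((-1) ^ (n + 1))).div_const 2).congr_deriv ?_
    simp only [smul_eq_mul]
    ring

lemma isBigO_mellinJet_atTop (n : ℕ) : mellinJet n =O[atTop] fun y => exp (-(1 / 2) * y) := by
  refine (((isBigO_expJet 0 n 0).const_mul_left (1 / 2)).sub ((Asymptotics.isBigO_refl
    (fun y : ℝ => exp (-(1 / 2) * y)) atTop).const_mul_left ((-(1 / 2)) ^ n / 2))).congr_left
      fun y => ?_
  rw [mellinJet]
  ring

lemma isBigO_expJet_neg (a : ℝ) (n i : ℕ) :
    (fun y => expJet a n i (-y)) =O[atBot] fun y => exp (1 / 2 * y) :=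
  ((isBigO_expJet a n i).comp_tendsto tendsto_neg_atBot_atTop).congr_right fun y => by
    simp only [Function.comp]
    congr 1
    ring

lemma isBigO_mellinJet_atBot (n : ℕ) :
    mellinJet (n + 1) =O[atBot] fun y => exp (1 / 2 * y) :=
  ((isBigO_expJet_neg (1 / 2) (n + 1) 0).const_mul_left ((-1) ^ (n + 1) / 2)).congr_left fun y => by
    rw [mellinJet_succ_eq_neg]
    ring

lemma isBigO_mellinJet_add_half_atBot :
    (fun y => mellinJet 0 y + 1 / 2) =O[atBot] fun y => exp (1 / 2 * y) :=
  ((isBigO_expJet_neg (1 / 2) 0 0).const_mul_left (1 / 2)).congr_left fun y => by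
    rw [mellinJet_zero_eq_neg]
    ring

lemma continuous_mellinJet (n : ℕ) : Continuous (mellinJet n) :=
  continuous_iff_continuousAt.2 fun y => (hasDerivAt_mellinJet n y).continuousAt

lemma integrableAtFilter_exp_atTop :
    IntegrableAtFilter (fun y : ℝ => exp (-(1 / 2) * y)) atTop :=
  ⟨Ioi 0, Ioi_mem_atTop 0, exp_neg_integrableOn_Ioi 0 (by norm_num)⟩

lemma integrableAtFilter_exp_atBot :
    IntegrableAtFilter (fun y : ℝ => exp (1 / 2 * y)) atBot :=
  ⟨Iic 0, Iic_mem_atBot 0, integrableOn_exp_mul_Iic (by norm_num) 0⟩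

lemma integrable_mellinJet (n : ℕ) : Integrable (mellinJet (n + 1)) :=
  (continuous_mellinJet (n + 1)).locallyIntegrable.integrable_of_isBigO_atBot_atTop
    (isBigO_mellinJet_atBot n) integrableAtFilter_exp_atBot
    (isBigO_mellinJet_atTop (n + 1)) integrableAtFilter_exp_atTop

lemma integrableOn_mellinJet_zero : IntegrableOn (mellinJet 0) (Ioi 0) :=
  ((continuous_mellinJet 0).locallyIntegrable.locallyIntegrableOn (Ici 0)).integrableOn_of_isBigO_atTop
    (isBigO_mellinJet_atTop 0) integrableAtFilter_exp_atTop |>.mono_set Ioi_subset_Ici_self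

lemma integrableOn_mellinJet_zero_add_half :
    IntegrableOn (fun y => mellinJet 0 y + 1 / 2) (Iic 0) :=
  (((continuous_mellinJet 0).add continuous_const).locallyIntegrable.locallyIntegrableOn
    (Iic 0)).integrableOn_of_isBigO_atBot
    isBigO_mellinJet_add_half_atBot integrableAtFilter_exp_atBot

lemma expJet_zero_zero (i : ℕ) : expJet 0 0 (i + 1) 0 = thetaSeries (fun _ => 1) (i + 1) 1 := by
  rw [expJet, thetaTail, thetaSeries_succ_eq (fun _ => 1)]
  simp

lemma expJet_succ (a : ℝ) (n i : ℕ) (y : ℝ) :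
    expJet a (n + 1) i y = (a + i) * expJet a n i y - π * expJet a n (i + 1) y := rfl

/-! ### Fourier inversion for smooth functions with integrable derivatives. -/

lemma norm_fourier_le_integral_norm (f : ℝ → ℂ) (ξ : ℝ) : ‖𝓕 f ξ‖ ≤ ∫ y, ‖f y‖ := by
  rw [fourier_real_eq]
  refine (norm_integral_le_integral_norm _).trans_eq ?_
  simp_rw [Circle.norm_smul]

/-- The L¹ norms of f and f'' together bound (1 + ξ²)|𝓕 f(ξ)|, since (2π)² ≥ 1. -/
lemma integrable_fourier_of_iteratedDeriv {f : ℝ → ℂ} (hf : ContDiff ℝ (⊤ : ℕ∞) f)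
    (hint : ∀ n : ℕ, Integrable (iteratedDeriv n f)) : Integrable (𝓕 f) := by
  have hf0 : Integrable f := by simpa using hint 0
  have hc : Continuous (𝓕 f) :=
    VectorFourier.fourierIntegral_continuous continuous_fourierChar
      (by exact continuous_inner) hf0
  refine (integrable_inv_one_add_sq.const_mul
    ((∫ y, ‖f y‖) + ∫ y, ‖iteratedDeriv 2 f y‖)).mono' hc.aestronglyMeasurable
    (ae_of_all _ fun ξ => ?_)
  rw [← div_eq_mul_inv, le_div_iff₀ (by positivity), mul_add, mul_one]
  refine add_le_add (norm_fourier_le_integral_norm f ξ) ?_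
  refine le_trans ?_ (norm_fourier_le_integral_norm (iteratedDeriv 2 f) ξ)
  rw [Real.fourier_iteratedDeriv hf (fun n _ => hint n) (by exact le_top), norm_smul, norm_pow,
    mul_comm]
  refine mul_le_mul_of_nonneg_right ?_ (norm_nonneg _)
  have hn : ‖(2 * π * Complex.I * ξ : ℂ)‖ = 2 * π * |ξ| := by
    simp [abs_of_pos pi_pos]
  rw [hn, mul_pow, sq_abs]
  have : 1 ≤ (2 * π) ^ 2 := one_le_pow₀ (by linarith [pi_gt_three])
  nlinarith [sq_nonneg ξ]

/-- This is inversion at the origin for the j-th derivative, whose transform is (2πiξ)^j 𝓕 f. -/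
lemma fourier_inversion_iteratedDeriv {f : ℝ → ℂ} (hf : ContDiff ℝ (⊤ : ℕ∞) f)
    (hint : ∀ n : ℕ, Integrable (iteratedDeriv n f)) (j : ℕ) :
    Integrable (fun ξ : ℝ => (2 * π * Complex.I * ξ) ^ j * 𝓕 f ξ) ∧
      ∫ ξ : ℝ, (2 * π * Complex.I * ξ) ^ j * 𝓕 f ξ = iteratedDeriv j f 0 := by
  have hj : ContDiff ℝ (⊤ : ℕ∞) (iteratedDeriv j f) := by
    rw [iteratedDeriv_eq_iterate]
    exact ContDiff.iterate_deriv j hf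
  have hij : ∀ n : ℕ, Integrable (iteratedDeriv n (iteratedDeriv j f)) := fun n => by
    have := hint (n + j)
    rwa [iteratedDeriv_eq_iterate, Function.iterate_add_apply, ← iteratedDeriv_eq_iterate,
      ← iteratedDeriv_eq_iterate] at this
  have hF := integrable_fourier_of_iteratedDeriv hj hij
  have hinv := (hint j).fourierInv_fourier_eq hF (v := 0) hj.continuous.continuousAt
  have he := Real.fourier_iteratedDeriv hf (fun n _ => hint n) (n := j) (by exact le_top)
  simp_rw [smul_eq_mul] at he
  rw [Real.fourierInv_eq'] at hinv
  simp only [inner_zero_right, mul_zero, Complex.ofReal_zero, zero_mul, Complex.exp_zero,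
    one_smul] at hinv
  rw [he] at hF hinv
  exact ⟨hF, hinv⟩

lemma iteratedDeriv_ofReal_mellinJet (n : ℕ) :
    iteratedDeriv n (fun y => (mellinJet 1 y : ℂ)) = fun y => (mellinJet (n + 1) y : ℂ) := by
  induction n with
  | zero => simp
  | succ n ih =>
    rw [iteratedDeriv_succ, ih]
    exact funext fun y => (hasDerivAt_mellinJet (n + 1) y).ofReal_comp.deriv

lemma contDiff_ofReal_mellinJet : ContDiff ℝ (⊤ : ℕ∞) fun y => (mellinJet 1 y : ℂ) := by
  refine contDiff_of_differentiable_iteratedDeriv fun m _ => ?_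
  rw [iteratedDeriv_ofReal_mellinJet]
  exact fun y => (hasDerivAt_mellinJet (m + 1) y).ofReal_comp.differentiableAt

lemma integrable_iteratedDeriv_ofReal_mellinJet (n : ℕ) :
    Integrable (iteratedDeriv n fun y => (mellinJet 1 y : ℂ)) := by
  rw [iteratedDeriv_ofReal_mellinJet]
  exact (integrable_mellinJet n).ofReal

/-! ### Υ on the imaginary axis as a Fourier transform. -/

lemma evenKernel_zero_eq_thetaThree {t : ℝ} (ht : 0 < t) :
    HurwitzZeta.evenKernel 0 t = thetaThree t := by
  have h := HurwitzZeta.hasSum_int_evenKernel 0 ht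
  rw [QuotientAddGroup.mk_zero] at h
  rw [← h.tsum_eq, thetaThree, thetaSeries]
  simp

/-- The modified kernel subtracts 1 for t > 1 and t^(-1/2) for t < 1, whereas M subtracts both
everywhere; the difference is restored on each side. The point y = 0 is left out because both
indicators vanish at t = 1. -/
lemma f_modif_exp {y : ℝ} (hy : y ≠ 0) : (HurwitzZeta.hurwitzEvenFEPair 0).f_modif (exp y) =
    if 0 < y then ((2 * mellinJet 0 y + exp (-(1 / 2) * y) : ℝ) : ℂ)
      else ((2 * (mellinJet 0 y + 1 / 2) : ℝ) : ℂ) := by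
  have hexp : exp y ^ (-(1 / 2) : ℝ) = exp (-(1 / 2) * y) := by rw [← exp_mul, mul_comm]
  have hk : HurwitzZeta.evenKernel 0 (exp y) = 2 * mellinJet 0 y + 1 + exp (-(1 / 2) * y) := by
    rw [evenKernel_zero_eq_thetaThree (exp_pos y), thetaThree_exp_eq]
  simp only [WeakFEPair.f_modif, Pi.add_apply, HurwitzZeta.hurwitzEvenFEPair]
  by_cases h : 0 < y
  · rw [if_pos h, indicator_of_mem (by simpa using h), indicator_of_notMem (by simp [h.le])]
    simp only [Function.comp, hk, if_true]
    push_cast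
    ring
  · have h' : y < 0 := lt_of_le_of_ne (not_lt.1 h) hy
    rw [if_neg h, indicator_of_notMem (by simp [h'.le]),
      indicator_of_mem (by simp [h', exp_pos])]
    simp only [Function.comp, hk, hexp, smul_eq_mul, one_mul, mul_one]
    push_cast
    ring

lemma cexp_norm (v y : ℝ) : ‖Complex.exp (v * Complex.I * y)‖ = 1 := by
  rw [show (v * Complex.I * y : ℂ) = ((v * y : ℝ) : ℂ) * Complex.I by push_cast; ring]
  exact Complex.norm_exp_ofReal_mul_I _

lemma integrable_cexp_mul {s : Set ℝ} (v : ℝ) {f : ℝ → ℝ} (hf : IntegrableOn f s) :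
    IntegrableOn (fun y : ℝ => Complex.exp (v * Complex.I * y) * (f y : ℂ)) s := by
  refine hf.ofReal.bdd_mul (c := 1) ?_ (ae_of_all _ fun y => (cexp_norm v y).le)
  exact (by fun_prop : Continuous fun y : ℝ =>
    Complex.exp (v * Complex.I * y)).aestronglyMeasurable

/-- The Mellin integral is written in the variable y = log t. The leftover e^(-y/2) on (0, ∞)
integrates to the term 1/(1 - s) at s = 2iv, which cancels against the same term in `Upsilon_eq`. -/
lemma completedRiemannZeta₀_eq_integral (v : ℝ) : completedRiemannZeta₀ (2 * Complex.I * v) =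
    (∫ y in Iic (0 : ℝ), Complex.exp (v * Complex.I * y) * ((mellinJet 0 y + 1 / 2 : ℝ) : ℂ)) +
    (∫ y in Ioi (0 : ℝ), Complex.exp (v * Complex.I * y) * (mellinJet 0 y : ℂ)) +
      1 / (1 - 2 * Complex.I * v) := by
  have h1 : completedRiemannZeta₀ (2 * Complex.I * v) =
      (∫ y : ℝ, Complex.exp (v * Complex.I * y) *
        (HurwitzZeta.hurwitzEvenFEPair 0).f_modif (exp y)) / 2 := by
    rw [completedRiemannZeta₀, HurwitzZeta.completedHurwitzZetaEven₀, WeakFEPair.Λ₀,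
      mellin_eq_fourier, fourier_real_eq_integral_exp_smul, ← integral_neg_eq_self]
    congr 1
    refine integral_congr_ae (ae_of_all _ fun y => ?_)
    simp only [smul_eq_mul]
    have hre : ((2 * Complex.I * v / 2 : ℂ)).re = 0 := by simp
    have him : ((2 * Complex.I * v / 2 : ℂ)).im = v := by simp
    rw [hre, him, neg_neg]
    have : -2 * π * -y * (v / (2 * π)) = v * y := by field_simp
    rw [this]
    simp
    ring_nf
    simp
  have hsplit : ∀ y : ℝ, y ≠ 0 → Complex.exp (v * Complex.I * y) *
      (HurwitzZeta.hurwitzEvenFEPair 0).f_modif (exp y) =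
      (Iic (0 : ℝ)).indicator (fun y : ℝ => 2 * (Complex.exp (v * Complex.I * y) *
        ((mellinJet 0 y + 1 / 2 : ℝ) : ℂ))) y +
      (Ioi (0 : ℝ)).indicator (fun y : ℝ => 2 * (Complex.exp (v * Complex.I * y) *
        (mellinJet 0 y : ℂ)) + Complex.exp ((-(1 / 2) + v * Complex.I) * y)) y := by
    intro y hy
    rw [f_modif_exp hy]
    split_ifs with h
    · rw [indicator_of_notMem (by simpa using h), indicator_of_mem (by simpa using h), add_mul,
        Complex.exp_add]
      push_cast
      ring
    · rw [indicator_of_mem (by simpa using h), indicator_of_notMem (by simpa using h)]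
      push_cast
      ring
  have hI := (integrable_cexp_mul v integrableOn_mellinJet_zero_add_half).const_mul 2
  have hJ := (integrable_cexp_mul v integrableOn_mellinJet_zero).const_mul 2
  have hre : ((-(1 / 2) + v * Complex.I : ℂ)).re < 0 := by simp
  have hK := integrableOn_exp_mul_complex_Ioi hre 0
  have hJK : IntegrableOn (fun y : ℝ => 2 * (Complex.exp (v * Complex.I * y) *
      (mellinJet 0 y : ℂ)) + Complex.exp ((-(1 / 2) + v * Complex.I) * y)) (Ioi 0) := hJ.add hK
  have hae : ∀ᵐ y : ℝ, y ≠ 0 := compl_mem_ae_iff.2 (measure_singleton 0)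
  rw [h1, integral_congr_ae (hae.mono hsplit),
    integral_add ((integrable_indicator_iff measurableSet_Iic).2 hI)
      ((integrable_indicator_iff measurableSet_Ioi).2 hJK), integral_indicator measurableSet_Iic,
    integral_indicator measurableSet_Ioi, integral_add hJ hK, integral_exp_mul_complex_Ioi hre,
    integral_const_mul, integral_const_mul]
  have hne : (1 - 2 * Complex.I * v : ℂ) ≠ 0 := fun h => by
    have := congrArg Complex.re h
    simp at this
  have hne2 : (-(1 / 2) + v * Complex.I : ℂ) ≠ 0 := fun h => by
    rw [h] at hre
    simp at hre
  have : (-Complex.exp ((-(1 / 2) + v * Complex.I) * (0 : ℝ)) / (-(1 / 2) + v * Complex.I) : ℂ) =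
      2 * (1 / (1 - 2 * Complex.I * v)) := by
    simp only [Complex.ofReal_zero, mul_zero, Complex.exp_zero]
    rw [mul_one_div, div_eq_div_iff hne2 hne]
    ring
  rw [this]
  ring

lemma Upsilon_eq {s : ℂ} (hs : ∀ n : ℕ, s ≠ -(2 * n)) :
    Upsilon s = completedRiemannZeta₀ s - 1 / s - 1 / (1 - s) := by
  have h0 : s ≠ 0 := by simpa using hs 0
  have hG : Complex.Gammaℝ s ≠ 0 := fun h => by
    obtain ⟨n, hn⟩ := Complex.Gammaℝ_eq_zero_iff.1 h
    exact hs n hn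
  rw [Upsilon, mul_assoc, mul_comm (Complex.Gamma _), ← Complex.Gammaℝ_def,
    riemannZeta_def_of_ne_zero h0, div_mul_cancel₀ _ hG, completedRiemannZeta_eq]

lemma hasDerivAt_cexp_mul (v : ℝ) {f : ℝ → ℝ} {f' y : ℝ} (hf : HasDerivAt f f' y) :
    HasDerivAt (fun y : ℝ => Complex.exp (v * Complex.I * y) * (f y : ℂ))
      (v * Complex.I * (Complex.exp (v * Complex.I * y) * (f y : ℂ)) +
        Complex.exp (v * Complex.I * y) * (f' : ℂ)) y := by
  refine (((((hasDerivAt_id y).ofReal_comp).const_mul (v * Complex.I : ℂ)).cexp).mul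
    hf.ofReal_comp).congr_deriv ?_
  simp only [id, Complex.ofReal_one]
  ring

lemma tendsto_cexp_mul {l : Filter ℝ} (v : ℝ) {f : ℝ → ℝ} (hf : Tendsto f l (𝓝 0)) :
    Tendsto (fun y : ℝ => Complex.exp (v * Complex.I * y) * (f y : ℂ)) l (𝓝 0) := by
  rw [tendsto_zero_iff_norm_tendsto_zero]
  refine (tendsto_zero_iff_norm_tendsto_zero.1 hf).congr fun y => ?_
  rw [norm_mul, cexp_norm, one_mul, Complex.norm_real]

lemma tendsto_mellinJet_zero_atTop : Tendsto (mellinJet 0) atTop (𝓝 0) :=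
  (isBigO_mellinJet_atTop 0).trans_tendsto
    (tendsto_exp_atBot.comp (tendsto_id.const_mul_atTop_of_neg (by norm_num)))

lemma tendsto_mellinJet_zero_add_half_atBot :
    Tendsto (fun y => mellinJet 0 y + 1 / 2) atBot (𝓝 0) :=
  isBigO_mellinJet_add_half_atBot.trans_tendsto
    (tendsto_exp_atBot.comp (tendsto_id.const_mul_atBot (by norm_num)))

/-- Integration by parts is done on each half line, with M + 1/2 on the left so that the function
vanishes at -∞. The boundary terms at 0 add up to 1/2, which is the contribution of the pole term
-1/s. -/
lemma integral_cexp_mul_mellinJet {v : ℝ} (hv : v ≠ 0) :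
    ∫ y : ℝ, Complex.exp (v * Complex.I * y) * (mellinJet 1 y : ℂ) =
      -Complex.I * v * Upsilon (2 * Complex.I * v) := by
  have hi0 := integrable_mellinJet 0
  have hR := integrable_cexp_mul v integrableOn_mellinJet_zero
  have hL := integrable_cexp_mul v integrableOn_mellinJet_zero_add_half
  have hR' := integrable_cexp_mul v (hi0.integrableOn (s := Ioi 0))
  have hL' := integrable_cexp_mul v (hi0.integrableOn (s := Iic 0))
  have h1 := integral_Ioi_of_hasDerivAt_of_tendsto'
    (fun y _ => hasDerivAt_cexp_mul v (hasDerivAt_mellinJet 0 y))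
    ((hR.const_mul (v * Complex.I : ℂ)).add hR')
    (tendsto_cexp_mul v tendsto_mellinJet_zero_atTop) (a := 0)
  have h2 := integral_Iic_of_hasDerivAt_of_tendsto'
    (fun y _ => hasDerivAt_cexp_mul v ((hasDerivAt_mellinJet 0 y).add_const (1 / 2)))
    ((hL.const_mul (v * Complex.I : ℂ)).add hL')
    (tendsto_cexp_mul v tendsto_mellinJet_zero_add_half_atBot) (a := 0)
  rw [integral_add (hR.const_mul _) hR', integral_const_mul] at h1
  rw [integral_add (hL.const_mul _) hL', integral_const_mul] at h2
  rw [← setIntegral_univ, ← Iic_union_Ioi (a := (0 : ℝ)),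
    setIntegral_union (Iic_disjoint_Ioi le_rfl) measurableSet_Ioi hL' hR']
  have hne : ∀ n : ℕ, 2 * Complex.I * (v : ℂ) ≠ -(2 * n) := fun n h => by
    have := congrArg Complex.im h
    simp [hv] at this
  rw [Upsilon_eq hne, completedRiemannZeta₀_eq_integral]
  have hI : -Complex.I * v * (1 / (2 * Complex.I * v)) = -(1 / 2) := by
    have : (v : ℂ) ≠ 0 := by exact_mod_cast hv
    field_simp
  simp only [Complex.ofReal_zero, mul_zero, Complex.exp_zero, one_mul, zero_sub, sub_zero] at h1 h2
  push_cast at h1 h2 ⊢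
  linear_combination h1 + h2 + hI

lemma fourier_ofReal_neg (f : ℝ → ℝ) (ξ : ℝ) :
    𝓕 (fun y => (f y : ℂ)) (-ξ) = starRingEnd ℂ (𝓕 (fun y => (f y : ℂ)) ξ) := by
  rw [fourier_real_eq_integral_exp_smul, fourier_real_eq_integral_exp_smul, ← integral_conj]
  refine integral_congr_ae (ae_of_all _ fun y => ?_)
  simp only [smul_eq_mul, map_mul, Complex.conj_ofReal, ← Complex.exp_conj, Complex.conj_I]
  congr 2
  push_cast
  ring

lemma fourier_mellinJet {ξ : ℝ} (hξ : ξ ≠ 0) : 𝓕 (fun y => (mellinJet 1 y : ℂ)) ξ =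
    2 * π * Complex.I * ξ * Upsilon (2 * Complex.I * (-(2 * π) * ξ : ℝ)) := by
  have h := integral_cexp_mul_mellinJet (v := -(2 * π) * ξ)
    (mul_ne_zero (neg_ne_zero.2 two_pi_pos.ne') hξ)
  rw [fourier_real_eq_integral_exp_smul]
  have h2 : 2 * π * Complex.I * ξ * Upsilon (2 * Complex.I * (-(2 * π) * ξ : ℝ)) =
      -Complex.I * (-(2 * π) * ξ : ℝ) * Upsilon (2 * Complex.I * (-(2 * π) * ξ : ℝ)) := by
    push_cast
    ring
  rw [h2, ← h]
  refine integral_congr_ae (ae_of_all _ fun y => ?_)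
  simp only [smul_eq_mul]
  congr 2
  push_cast
  ring

/-! ### Inversion on the imaginary axis and the seven integrals. -/

/-- Mellin inversion for `Υ` on the imaginary axis, weighted by `v ^ (j + 1)`. -/
lemma hasHalfLineIntegral_re_pow_mul_Upsilon (j : ℕ) :
    HasHalfLineIntegral
      (fun v : ℝ => ((-Complex.I * v) ^ (j + 1) * Upsilon (2 * Complex.I * v)).re)
      (π * mellinJet (j + 1) 0) := by
  set H : ℝ → ℂ := fun ξ => (2 * π * Complex.I * ξ) ^ j * 𝓕 (fun y => (mellinJet 1 y : ℂ)) ξ with hH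
  obtain ⟨hint, hval⟩ : Integrable H ∧ ∫ ξ, H ξ = _ := fourier_inversion_iteratedDeriv
    contDiff_ofReal_mellinJet integrable_iteratedDeriv_ofReal_mellinJet j
  rw [iteratedDeriv_ofReal_mellinJet] at hval
  -- The scaling ξ = cv makes 2πiξ equal to -iv, and the change of variables contributes the factor
  -- 2π.
  set c : ℝ := (-(2 * π))⁻¹ with hc
  have hc0 : -(2 * π) ≠ 0 := neg_ne_zero.2 two_pi_pos.ne'
  have hcne : c ≠ 0 := inv_ne_zero hc0
  have hGint : Integrable fun v : ℝ => (H (c * v)).re := (hint.comp_mul_left' hcne).re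
  have hGval : ∫ v : ℝ, (H (c * v)).re = 2 * (π * mellinJet (j + 1) 0) := by
    have h1 := integral_re (hint.comp_mul_left' hcne)
    simp only [RCLike.re_to_complex] at h1
    rw [h1, Measure.integral_comp_mul_left H c, hval, hc, inv_inv, abs_neg,
      abs_of_pos two_pi_pos, Complex.real_smul, ← Complex.ofReal_mul, Complex.ofReal_re]
    ring
  -- M' is real, so H(-ξ) is the conjugate of H(ξ). The real part is even, and the half line carries
  -- half of the integral.
  have heven : ∀ v : ℝ, (H (c * v)).re = (H (c * |v|)).re := fun v => by
    rcases abs_choice v with h | h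
    · rw [h]
    · have hneg : ∀ ξ : ℝ, H (-ξ) = starRingEnd ℂ (H ξ) := fun ξ => by
        simp only [hH]
        rw [fourier_ofReal_neg, map_mul, map_pow]
        congr 2
        simp [map_ofNat]
      rw [h, mul_neg, hneg, Complex.conj_re]
  have hG : ∀ v ∈ Ioi (0 : ℝ), (H (c * v)).re =
      ((-Complex.I * v) ^ (j + 1) * Upsilon (2 * Complex.I * v)).re := fun v hv => by
    have hv0 : v ≠ 0 := ne_of_gt hv
    have hcv : -(2 * π) * (c * v) = v := by rw [hc, mul_inv_cancel_left₀ hc0]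
    have h2 : (2 * π * Complex.I * (c * v : ℝ) : ℂ) = -Complex.I * v := by
      nth_rewrite 2 [← hcv]
      push_cast
      ring
    simp only [hH]
    rw [fourier_mellinJet (mul_ne_zero hcne hv0), hcv, h2]
    congr 1
    ring
  refine ⟨hGint.integrableOn.congr_fun hG measurableSet_Ioi, ?_⟩
  rw [← setIntegral_congr_fun measurableSet_Ioi hG]
  have h3 := integral_comp_abs (f := fun v => (H (c * v)).re)
  simp_rw [← heven] at h3
  rw [hGval] at h3
  linarith

/-- The case i = 0 is never needed: the derivatives in question have a = 0, so the coefficient a + i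
kills it in the recursion. -/
lemma expJet_zero_eq_value {i : ℕ} (h0 : i ≠ 0) (hi : i < 8) : expJet 0 0 i 0 =
    thetaThreeValue (π ^ (1 / 4 : ℝ)) (Gamma (3 / 4)) i / (-π) ^ i := by
  obtain ⟨i, rfl⟩ := Nat.exists_eq_succ_of_ne_zero h0
  rw [Nat.succ_eq_add_one, expJet_zero_zero, thetaSeries_one_eq_value hi]

lemma HasHalfLineIntegral.congr {f g : ℝ → ℝ} {a b : ℝ} (h : HasHalfLineIntegral f a)
    (hfg : ∀ v, f v = g v) (hab : a = b) : HasHalfLineIntegral g b := by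
  rwa [← funext hfg, ← hab]

lemma neg_I_mul_sq (v : ℝ) : (-Complex.I * v) ^ 2 = ((-1 * v ^ 2 : ℝ) : ℂ) := by
  rw [mul_pow, neg_sq, Complex.I_sq]
  push_cast
  ring

lemma hasHalfLineIntegral_pow_odd_mul_UpsilonI (m : ℕ) :
    HasHalfLineIntegral (fun v => v ^ (2 * m + 1) * UpsilonI (2 * Complex.I * v))
      ((-1) ^ m * (π * mellinJet (2 * m + 1) 0)) := by
  obtain ⟨h1, h2⟩ := hasHalfLineIntegral_re_pow_mul_Upsilon (2 * m)
  have h : ∀ v : ℝ, v ^ (2 * m + 1) * UpsilonI (2 * Complex.I * v) = (-1) ^ m *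
      ((-Complex.I * v) ^ (2 * m + 1) * Upsilon (2 * Complex.I * v)).re := fun v => by
    have e : (-Complex.I * v) ^ (2 * m + 1) * Upsilon (2 * Complex.I * v) =
        (((-1) ^ m * v ^ (2 * m + 1) : ℝ) : ℂ) * (-Complex.I * Upsilon (2 * Complex.I * v)) := by
      rw [pow_succ (-Complex.I * v), pow_mul, neg_I_mul_sq]
      push_cast
      ring
    have hre : (-Complex.I * Upsilon (2 * Complex.I * v)).re = UpsilonI (2 * Complex.I * v) := by
      simp [UpsilonI]
    rw [e, Complex.re_ofReal_mul, hre, ← mul_assoc, ← mul_assoc, ← mul_pow]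
    norm_num
  simp_rw [h]
  exact ⟨h1.const_mul _, by rw [integral_const_mul, h2]⟩

lemma hasHalfLineIntegral_pow_even_mul_UpsilonR (m : ℕ) :
    HasHalfLineIntegral (fun v => v ^ (2 * m + 2) * UpsilonR (2 * Complex.I * v))
      ((-1) ^ (m + 1) * (π * mellinJet (2 * m + 2) 0)) := by
  obtain ⟨h1, h2⟩ := hasHalfLineIntegral_re_pow_mul_Upsilon (2 * m + 1)
  have h : ∀ v : ℝ, v ^ (2 * m + 2) * UpsilonR (2 * Complex.I * v) = (-1) ^ (m + 1) *
      ((-Complex.I * v) ^ (2 * m + 1 + 1) * Upsilon (2 * Complex.I * v)).re := fun v => by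
    have e : (-Complex.I * v) ^ (2 * m + 1 + 1) =
        (((-1) ^ (m + 1) * v ^ (2 * m + 2) : ℝ) : ℂ) := by
      rw [show 2 * m + 1 + 1 = 2 * (m + 1) by ring, pow_mul, neg_I_mul_sq]
      push_cast
      ring
    rw [e, Complex.re_ofReal_mul, UpsilonR, ← mul_assoc, ← mul_assoc, ← mul_pow]
    norm_num
  simp_rw [h]
  exact ⟨h1.const_mul _, by rw [integral_const_mul, h2]⟩

lemma hasHalfLineIntegral_pow_1_mul_UpsilonI :
    HasHalfLineIntegral (fun v : ℝ => v * UpsilonI (2 * Complex.I * v))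
    (-π / 4 * (π ^ (1 / 4 : ℝ) / (2 * Gamma (3 / 4)) - 1)) := by
  refine (hasHalfLineIntegral_pow_odd_mul_UpsilonI 0).congr (fun v => by simp) ?_
  have hG : Gamma (3 / 4) ≠ 0 := (Gamma_pos_of_pos (by norm_num)).ne'
  have hp : π ^ (1 / 4 : ℝ) ≠ 0 := (rpow_pos_of_pos pi_pos _).ne'
  have hpi := pi_eq_pow
  -- Kept fully quantified, so that the generalizations below also reach it and `simp` can use it
  -- for every index.
  have hv := @expJet_zero_eq_value
  generalize π ^ (1 / 4 : ℝ) = p at hp hpi hv ⊢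
  generalize Gamma (3 / 4) = g at hG hv ⊢
  simp [mellinJet, expJet_succ, hv, thetaThreeValue]
  rw [hpi]
  field_simp
  ring

lemma hasHalfLineIntegral_pow_2_mul_UpsilonR :
    HasHalfLineIntegral (fun v : ℝ => v ^ 2 * UpsilonR (2 * Complex.I * v))
    (π / 8 + π ^ (5 / 4 : ℝ) / (32 * Gamma (3 / 4)) - π ^ (21 / 4 : ℝ) / (64 * Gamma (3 / 4) ^ 9)) := by
  refine (hasHalfLineIntegral_pow_even_mul_UpsilonR 0).congr (fun v => rfl) ?_
  have hG : Gamma (3 / 4) ≠ 0 := (Gamma_pos_of_pos (by norm_num)).ne'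
  have hp : π ^ (1 / 4 : ℝ) ≠ 0 := (rpow_pos_of_pos pi_pos _).ne'
  rw [pi_rpow_eq_pow (a := 5 / 4) 5 (by norm_num), pi_rpow_eq_pow (a := 21 / 4) 21 (by norm_num)]
  have hpi := pi_eq_pow
  have hv := @expJet_zero_eq_value
  generalize π ^ (1 / 4 : ℝ) = p at hp hpi hv ⊢
  generalize Gamma (3 / 4) = g at hG hv ⊢
  simp [mellinJet, expJet_succ, hv, thetaThreeValue]
  rw [hpi]
  field_simp
  ring

lemma hasHalfLineIntegral_pow_3_mul_UpsilonI :
    HasHalfLineIntegral (fun v : ℝ => v ^ 3 * UpsilonI (2 * Complex.I * v))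
    ((3 * π ^ (21 / 4 : ℝ) - 10 * π ^ (5 / 4 : ℝ) * Gamma (3 / 4) ^ 8 - 16 * π * Gamma (3 / 4) ^ 9)
      / (256 * Gamma (3 / 4) ^ 9)) := by
  refine (hasHalfLineIntegral_pow_odd_mul_UpsilonI 1).congr (fun v => rfl) ?_
  have hG : Gamma (3 / 4) ≠ 0 := (Gamma_pos_of_pos (by norm_num)).ne'
  have hp : π ^ (1 / 4 : ℝ) ≠ 0 := (rpow_pos_of_pos pi_pos _).ne'
  rw [pi_rpow_eq_pow (a := 5 / 4) 5 (by norm_num), pi_rpow_eq_pow (a := 21 / 4) 21 (by norm_num)]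
  have hpi := pi_eq_pow
  have hv := @expJet_zero_eq_value
  generalize π ^ (1 / 4 : ℝ) = p at hp hpi hv ⊢
  generalize Gamma (3 / 4) = g at hG hv ⊢
  simp [mellinJet, expJet_succ, hv, thetaThreeValue]
  rw [hpi]
  field_simp
  ring

lemma hasHalfLineIntegral_pow_4_mul_UpsilonR :
    HasHalfLineIntegral (fun v : ℝ => v ^ 4 * UpsilonR (2 * Complex.I * v))
    ((-π ^ (37 / 4 : ℝ) - 76 * π ^ (21 / 4 : ℝ) * Gamma (3 / 4) ^ 8
      + 68 * π ^ (5 / 4 : ℝ) * Gamma (3 / 4) ^ 16 - 64 * π * Gamma (3 / 4) ^ 17) / (2048 * Gamma (3 / 4) ^ 17)) := by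
  refine (hasHalfLineIntegral_pow_even_mul_UpsilonR 1).congr (fun v => rfl) ?_
  have hG : Gamma (3 / 4) ≠ 0 := (Gamma_pos_of_pos (by norm_num)).ne'
  have hp : π ^ (1 / 4 : ℝ) ≠ 0 := (rpow_pos_of_pos pi_pos _).ne'
  rw [pi_rpow_eq_pow (a := 5 / 4) 5 (by norm_num), pi_rpow_eq_pow (a := 21 / 4) 21 (by norm_num), pi_rpow_eq_pow (a := 37 / 4) 37 (by norm_num)]
  have hpi := pi_eq_pow
  have hv := @expJet_zero_eq_value
  generalize π ^ (1 / 4 : ℝ) = p at hp hpi hv ⊢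
  generalize Gamma (3 / 4) = g at hG hv ⊢
  simp [mellinJet, expJet_succ, hv, thetaThreeValue]
  rw [hpi]
  field_simp
  ring

lemma hasHalfLineIntegral_pow_5_mul_UpsilonI :
    HasHalfLineIntegral (fun v : ℝ => v ^ 5 * UpsilonI (2 * Complex.I * v))
    ((5 * π ^ (37 / 4 : ℝ) + 420 * π ^ (21 / 4 : ℝ) * Gamma (3 / 4) ^ 8
      - 484 * π ^ (5 / 4 : ℝ) * Gamma (3 / 4) ^ 16 + 128 * π * Gamma (3 / 4) ^ 17) / (8192 * Gamma (3 / 4) ^ 17)) := by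
  refine (hasHalfLineIntegral_pow_odd_mul_UpsilonI 2).congr (fun v => rfl) ?_
  have hG : Gamma (3 / 4) ≠ 0 := (Gamma_pos_of_pos (by norm_num)).ne'
  have hp : π ^ (1 / 4 : ℝ) ≠ 0 := (rpow_pos_of_pos pi_pos _).ne'
  rw [pi_rpow_eq_pow (a := 5 / 4) 5 (by norm_num), pi_rpow_eq_pow (a := 21 / 4) 21 (by norm_num), pi_rpow_eq_pow (a := 37 / 4) 37 (by norm_num)]
  have hpi := pi_eq_pow
  have hv := @expJet_zero_eq_value
  generalize π ^ (1 / 4 : ℝ) = p at hp hpi hv ⊢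
  generalize Gamma (3 / 4) = g at hG hv ⊢
  simp [mellinJet, expJet_succ, hv, thetaThreeValue]
  rw [hpi]
  field_simp
  ring

lemma hasHalfLineIntegral_pow_6_mul_UpsilonR :
    HasHalfLineIntegral (fun v : ℝ => v ^ 6 * UpsilonR (2 * Complex.I * v))
    (1 / (65536 * Gamma (3 / 4) ^ 25) * (-51 * π ^ (53 / 4 : ℝ) - 350 * π ^ (37 / 4 : ℝ) * Gamma (3 / 4) ^ 8
      - 11644 * π ^ (21 / 4 : ℝ) * Gamma (3 / 4) ^ 16 + 5768 * π ^ (5 / 4 : ℝ) * Gamma (3 / 4) ^ 24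
      + 512 * π * Gamma (3 / 4) ^ 25)) := by
  refine (hasHalfLineIntegral_pow_even_mul_UpsilonR 2).congr (fun v => rfl) ?_
  have hG : Gamma (3 / 4) ≠ 0 := (Gamma_pos_of_pos (by norm_num)).ne'
  have hp : π ^ (1 / 4 : ℝ) ≠ 0 := (rpow_pos_of_pos pi_pos _).ne'
  rw [pi_rpow_eq_pow (a := 5 / 4) 5 (by norm_num), pi_rpow_eq_pow (a := 21 / 4) 21 (by norm_num), pi_rpow_eq_pow (a := 37 / 4) 37 (by norm_num), pi_rpow_eq_pow (a := 53 / 4) 53 (by norm_num)]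
  have hpi := pi_eq_pow
  have hv := @expJet_zero_eq_value
  generalize π ^ (1 / 4 : ℝ) = p at hp hpi hv ⊢
  generalize Gamma (3 / 4) = g at hG hv ⊢
  simp [mellinJet, expJet_succ, hv, thetaThreeValue]
  rw [hpi]
  field_simp
  ring

lemma hasHalfLineIntegral_pow_7_mul_UpsilonI :
    HasHalfLineIntegral (fun v : ℝ => v ^ 7 * UpsilonI (2 * Complex.I * v))
    (1 / (262144 * Gamma (3 / 4) ^ 25) * (357 * π ^ (53 / 4 : ℝ) + 2590 * π ^ (37 / 4 : ℝ) * Gamma (3 / 4) ^ 8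
      + 93492 * π ^ (21 / 4 : ℝ) * Gamma (3 / 4) ^ 16 - 54760 * π ^ (5 / 4 : ℝ) * Gamma (3 / 4) ^ 24
      - 1024 * π * Gamma (3 / 4) ^ 25)) := by
  refine (hasHalfLineIntegral_pow_odd_mul_UpsilonI 3).congr (fun v => rfl) ?_
  have hG : Gamma (3 / 4) ≠ 0 := (Gamma_pos_of_pos (by norm_num)).ne'
  have hp : π ^ (1 / 4 : ℝ) ≠ 0 := (rpow_pos_of_pos pi_pos _).ne'
  rw [pi_rpow_eq_pow (a := 5 / 4) 5 (by norm_num), pi_rpow_eq_pow (a := 21 / 4) 21 (by norm_num), pi_rpow_eq_pow (a := 37 / 4) 37 (by norm_num), pi_rpow_eq_pow (a := 53 / 4) 53 (by norm_num)]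
  have hpi := pi_eq_pow
  have hv := @expJet_zero_eq_value
  generalize π ^ (1 / 4 : ℝ) = p at hp hpi hv ⊢
  generalize Gamma (3 / 4) = g at hG hv ⊢
  simp [mellinJet, expJet_succ, hv, thetaThreeValue]
  rw [hpi]
  field_simp
  ring

theorem mainTheorem6 :
    HasSum (fun n : ℕ+ => -(n : ℝ) ^ 2 * exp (-π * (n : ℝ) ^ 2))
      (-1 / (8 * π ^ (3 / 4 : ℝ) * Gamma (3 / 4))) ∧
    HasSum (fun n : ℕ+ => (n : ℝ) ^ 4 * exp (-π * (n : ℝ) ^ 2))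
      ((3 + π ^ 4 / (2 * Gamma (3 / 4) ^ 8)) / (32 * π ^ (7 / 4 : ℝ) * Gamma (3 / 4))) ∧
    HasSum (fun n : ℕ+ => -(n : ℝ) ^ 6 * exp (-π * (n : ℝ) ^ 2))
      (-15 / (128 * π ^ (11 / 4 : ℝ) * Gamma (3 / 4)) - 15 * π ^ (5 / 4 : ℝ) / (256 * Gamma (3 / 4) ^ 9)) ∧
    HasSum (fun n : ℕ+ => (n : ℝ) ^ 8 * exp (-π * (n : ℝ) ^ 2))
      (105 / (512 * π ^ (15 / 4 : ℝ) * Gamma (3 / 4)) + 105 * π ^ (1 / 4 : ℝ) / (512 * Gamma (3 / 4) ^ 9)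
        - π ^ (17 / 4 : ℝ) / (2048 * Gamma (3 / 4) ^ 17)) ∧
    HasSum (fun n : ℕ+ => -(n : ℝ) ^ 10 * exp (-π * (n : ℝ) ^ 2))
      (-945 / (2048 * π ^ (19 / 4 : ℝ) * Gamma (3 / 4)) - 1575 / (2048 * π ^ (3 / 4 : ℝ) * Gamma (3 / 4) ^ 9)
        + 45 * π ^ (13 / 4 : ℝ) / (8192 * Gamma (3 / 4) ^ 17)) ∧
    HasSum (fun n : ℕ+ => (n : ℝ) ^ 12 * exp (-π * (n : ℝ) ^ 2))
      (10395 / (8192 * π ^ (23 / 4 : ℝ) * Gamma (3 / 4)) + 51975 / (16384 * π ^ (7 / 4 : ℝ) * Gamma (3 / 4) ^ 9)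
        - 1485 * π ^ (9 / 4 : ℝ) / (32768 * Gamma (3 / 4) ^ 17) + 51 * π ^ (25 / 4 : ℝ) / (65536 * Gamma (3 / 4) ^ 25)) ∧
    HasSum (fun n : ℕ+ => -(n : ℝ) ^ 14 * exp (-π * (n : ℝ) ^ 2))
      (-135135 / (32768 * π ^ (27 / 4 : ℝ) * Gamma (3 / 4)) - 945945 / (65536 * π ^ (11 / 4 : ℝ) * Gamma (3 / 4) ^ 9)
        + 45045 * π ^ (5 / 4 : ℝ) / (131072 * Gamma (3 / 4) ^ 17) - 4641 * π ^ (21 / 4 : ℝ) / (262144 * Gamma (3 / 4) ^ 25)) ∧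
    HasHalfLineIntegral (fun v : ℝ => v * UpsilonI (2 * Complex.I * v))
      (-π / 4 * (π ^ (1 / 4 : ℝ) / (2 * Gamma (3 / 4)) - 1)) ∧
    HasHalfLineIntegral (fun v : ℝ => v ^ 2 * UpsilonR (2 * Complex.I * v))
      (π / 8 + π ^ (5 / 4 : ℝ) / (32 * Gamma (3 / 4)) - π ^ (21 / 4 : ℝ) / (64 * Gamma (3 / 4) ^ 9)) ∧
    HasHalfLineIntegral (fun v : ℝ => v ^ 3 * UpsilonI (2 * Complex.I * v))
      ((3 * π ^ (21 / 4 : ℝ) - 10 * π ^ (5 / 4 : ℝ) * Gamma (3 / 4) ^ 8 - 16 * π * Gamma (3 / 4) ^ 9)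
        / (256 * Gamma (3 / 4) ^ 9)) ∧
    HasHalfLineIntegral (fun v : ℝ => v ^ 4 * UpsilonR (2 * Complex.I * v))
      ((-π ^ (37 / 4 : ℝ) - 76 * π ^ (21 / 4 : ℝ) * Gamma (3 / 4) ^ 8
        + 68 * π ^ (5 / 4 : ℝ) * Gamma (3 / 4) ^ 16 - 64 * π * Gamma (3 / 4) ^ 17) / (2048 * Gamma (3 / 4) ^ 17)) ∧
    HasHalfLineIntegral (fun v : ℝ => v ^ 5 * UpsilonI (2 * Complex.I * v))
      ((5 * π ^ (37 / 4 : ℝ) + 420 * π ^ (21 / 4 : ℝ) * Gamma (3 / 4) ^ 8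
        - 484 * π ^ (5 / 4 : ℝ) * Gamma (3 / 4) ^ 16 + 128 * π * Gamma (3 / 4) ^ 17) / (8192 * Gamma (3 / 4) ^ 17)) ∧
    HasHalfLineIntegral (fun v : ℝ => v ^ 6 * UpsilonR (2 * Complex.I * v))
      (1 / (65536 * Gamma (3 / 4) ^ 25) * (-51 * π ^ (53 / 4 : ℝ) - 350 * π ^ (37 / 4 : ℝ) * Gamma (3 / 4) ^ 8
        - 11644 * π ^ (21 / 4 : ℝ) * Gamma (3 / 4) ^ 16 + 5768 * π ^ (5 / 4 : ℝ) * Gamma (3 / 4) ^ 24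
        + 512 * π * Gamma (3 / 4) ^ 25)) ∧
    HasHalfLineIntegral (fun v : ℝ => v ^ 7 * UpsilonI (2 * Complex.I * v))
      (1 / (262144 * Gamma (3 / 4) ^ 25) * (357 * π ^ (53 / 4 : ℝ) + 2590 * π ^ (37 / 4 : ℝ) * Gamma (3 / 4) ^ 8
        + 93492 * π ^ (21 / 4 : ℝ) * Gamma (3 / 4) ^ 16 - 54760 * π ^ (5 / 4 : ℝ) * Gamma (3 / 4) ^ 24
        - 1024 * π * Gamma (3 / 4) ^ 25)) :=
  ⟨hasSum_pnat_pow_2,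
    hasSum_pnat_pow_4,
    hasSum_pnat_pow_6,
    hasSum_pnat_pow_8,
    hasSum_pnat_pow_10,
    hasSum_pnat_pow_12,
    hasSum_pnat_pow_14,
    hasHalfLineIntegral_pow_1_mul_UpsilonI,
    hasHalfLineIntegral_pow_2_mul_UpsilonR,
    hasHalfLineIntegral_pow_3_mul_UpsilonI,
    hasHalfLineIntegral_pow_4_mul_UpsilonR,
    hasHalfLineIntegral_pow_5_mul_UpsilonI,
    hasHalfLineIntegral_pow_6_mul_UpsilonR,
    hasHalfLineIntegral_pow_7_mul_UpsilonI⟩
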